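/- Let $N\ge 1$, $s\in(0,1)$, and let $p:\mathbb{R}^N\times\mathbb{R}^N\to\mathbb{R}$ be uniformly continuous and symmetric ($p(x,y)=p(y,x)$) with $1<\inf p\le p^+:=\sup p<\infty$ and $sp^+<N$. For a measurable set $A\subseteq\mathbb{R}^N$ and a continuous $q:\mathbb{R}^N\to\mathbb{R}$ with $1<\inf q\le\sup q<\infty$, let $L^{q(\cdot)}(A)$ be the space of measurable $u:A\to\mathbb{R}$ with $\int_A|u(x)|^{q(x)}\,dx<\infty$, normed by $$\|u\|_{L^{q(\cdot)}(A)}=\inf\Big\{\lambda>0:\int_A\Big|\frac{u(x)}{\lambda}\Big|^{q(x)}dx\le 1\Big\},$$ and let $L^{q(\cdot)}_{\mathrm{loc}}(\mathbb{R}^N)$ be the space of functions belonging to $L^{q(\cdot)}(K)$ for every compact $K\subset\mathbb{R}^N$, with the topology given by the seminorms $\|\cdot\|_{L^{q(\cdot)}(K)}$. Let $W^{s,p(\cdot,\cdot)}(\mathbb{R}^N)$ be the space of $u\in L^{p(x,x)}(\mathbb{R}^N)$ with $$\int_{\mathbb{R}^N}\int_{\mathbb{R}^N}\frac{|u(x)-u(y)|^{p(x,y)}}{|x-y|^{N+sp(x,y)}}\,dx\,dy<\infty,$$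 normed by $\|u\|_{L^{p(x,x)}(\mathbb{R}^N)}+[u]$, where $$[u]=\inf\Big\{\lambda>0:\int_{\mathbb{R}^N}\int_{\mathbb{R}^N}\frac{|u(x)-u(y)|^{p(x,y)}}{\lambda^{p(x,y)}|x-y|^{N+sp(x,y)}}\,dx\,dy<1\Big\}.$$ Functions that agree almost everywhere are identified. Put $p_s^*(x)=\dfrac{Np(x,x)}{N-sp(x,x)}$. Then: (i) For every uniformly continuous $r:\mathbb{R}^N\to\mathbb{R}$ with $1<\inf r\le\sup r<\infty$, $p(x,x)\le r(x)$ for all $x\in\mathbb{R}^N$ and $\inf_{x\in\mathbb{R}^N}(p_s^*(x)-r(x))>0$, one has $W^{s,p(\cdot,\cdot)}(\mathbb{R}^N)\subseteq L^{r(\cdot)}(\mathbb{R}^N)$, and the inclusion is a bounded linear map. (ii) For every continuous $r:\mathbb{R}^N\to\mathbb{R}$ with $1<\inf r\le\sup r<\infty$ and $r(x)<p_s^*(x)$ for all $x\in\mathbb{R}^N$, one has $W^{s,p(\cdot,\cdot)}(\mathbb{R}^N)\subseteq L^{r(\cdot)}_{\mathrm{loc}}(\mathbb{R}^N)$, the inclusion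 is continuous, and it is compact: every bounded sequence in $W^{s,p(\cdot,\cdot)}(\mathbb{R}^N)$ has a subsequence that converges in $L^{r(\cdot)}_{\mathrm{loc}}(\mathbb{R}^N)$. -/

import Mathlib

open MeasureTheory Filter Topology
open scoped ENNReal NNReal

namespace VarSobolev

/-- The class `C₊(X)` of continuous exponents `h` with `1 < inf h ≤ sup h < ∞`.
(In Lean the infimum of a real function that is not bounded below is `0`, so `1 < ⨅ x, h x`
includes boundedness below.) -/
def CPlus {X : Type*} [TopologicalSpace X] (h : X → ℝ) : Prop :=
  Continuous h ∧ 1 < ⨅ x, h x ∧ BddAbove (Set.range h)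

section Lebesgue

variable {X : Type*} [MeasurableSpace X]

/-- The modular `∫ |u(x)|^{q(x)} dμ`, with values in `[0, ∞]`. -/
noncomputable def modular (μ : Measure X) (q : X → ℝ) (u : X → ℝ) : ℝ≥0∞ :=
  ∫⁻ x, ENNReal.ofReal (|u x| ^ q x) ∂μ

/-- The variable exponent Lebesgue space `L^{q(·)}(μ)`, as a set of functions
(measurable with respect to the completion of `μ`). -/
def lebesgueSpace (μ : Measure X) (q : X → ℝ) : Set (X → ℝ) :=
  {u | AEMeasurable u μ ∧ modular μ q u < ∞}

/-- The Luxemburg norm `inf {t > 0 : ∫ |u(x)/t|^{q(x)} dμ ≤ 1}`, with value `∞` if there is no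
such `t`. -/
noncomputable def luxemburgNorm (μ : Measure X) (q : X → ℝ) (u : X → ℝ) : ℝ≥0∞ :=
  ⨅ (t : ℝ) (_ : 0 < t ∧ modular μ q (fun x => u x / t) ≤ 1), ENNReal.ofReal t

end Lebesgue

section Sobolev

variable {N : ℕ}

/-- The double integral
`∫∫ |u(x)-u(y)|^{p(x,y)} / (t^{p(x,y)} |x-y|^{N+s p(x,y)}) dx dy` over `ℝᴺ × ℝᴺ`. -/
noncomputable def gagliardoModular (s : ℝ)
    (p : EuclideanSpace ℝ (Fin N) × EuclideanSpace ℝ (Fin N) → ℝ)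
    (u : EuclideanSpace ℝ (Fin N) → ℝ) (t : ℝ) : ℝ≥0∞ :=
  ∫⁻ y, ∫⁻ x, ENNReal.ofReal
    (|u x - u y| ^ p (x, y) / (t ^ p (x, y) * ‖x - y‖ ^ ((N : ℝ) + s * p (x, y))))

/-- The seminorm `[u]_{s,p(·,·)} = inf {t > 0 : gagliardoModular s p u t < 1}`. -/
noncomputable def gagliardoSeminorm (s : ℝ)
    (p : EuclideanSpace ℝ (Fin N) × EuclideanSpace ℝ (Fin N) → ℝ)
    (u : EuclideanSpace ℝ (Fin N) → ℝ) : ℝ≥0∞ :=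
  ⨅ (t : ℝ) (_ : 0 < t ∧ gagliardoModular s p u t < 1), ENNReal.ofReal t

/-- The space `W^{s,p(·,·)}(ℝᴺ)`: functions in `L^{p(x,x)}(ℝᴺ)` with
`∫∫ |u(x)-u(y)|^{p(x,y)} / |x-y|^{N+s p(x,y)} dx dy < ∞`. -/
def sobolevSpace (s : ℝ) (p : EuclideanSpace ℝ (Fin N) × EuclideanSpace ℝ (Fin N) → ℝ) :
    Set (EuclideanSpace ℝ (Fin N) → ℝ) :=
  {u | u ∈ lebesgueSpace volume (fun x => p (x, x)) ∧ gagliardoModular s p u 1 < ∞}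

/-- The norm `‖u‖_{L^{p(x,x)}(ℝᴺ)} + [u]_{s,p(·,·)}` of `W^{s,p(·,·)}(ℝᴺ)`. -/
noncomputable def sobolevNorm (s : ℝ)
    (p : EuclideanSpace ℝ (Fin N) × EuclideanSpace ℝ (Fin N) → ℝ)
    (u : EuclideanSpace ℝ (Fin N) → ℝ) : ℝ≥0∞ :=
  luxemburgNorm volume (fun x => p (x, x)) u + gagliardoSeminorm s p u

/-- The critical exponent `p*_s(x) = N p(x,x) / (N - s p(x,x))`. -/
noncomputable def criticalExponent (s : ℝ)
    (p : EuclideanSpace ℝ (Fin N) × EuclideanSpace ℝ (Fin N) → ℝ)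
    (x : EuclideanSpace ℝ (Fin N)) : ℝ :=
  N * p (x, x) / (N - s * p (x, x))

/-- The local space `L^{q(·)}_loc(ℝᴺ)`: the functions that are in `L^{q(·)}(K)` for every compact
`K`. Its topology is given by the seminorms `‖·‖_{L^{q(·)}(K)}`, `K` compact. -/
def lebesgueLocSpace (q : EuclideanSpace ℝ (Fin N) → ℝ) : Set (EuclideanSpace ℝ (Fin N) → ℝ) :=
  {u | ∀ K : Set (EuclideanSpace ℝ (Fin N)), IsCompact K →
    u ∈ lebesgueSpace (volume.restrict K) q}

end Sobolev

/-- Continuous embedding `A ↪ B` of normed function spaces: `A ⊆ B`, and the inclusion is a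
bounded linear map. -/
def ContinuouslyEmbeds {V : Type*} (A : Set V) (normA : V → ℝ≥0∞) (B : Set V)
    (normB : V → ℝ≥0∞) : Prop :=
  A ⊆ B ∧ ∃ C : ℝ≥0, ∀ u ∈ A, normB u ≤ C * normA u

/-- Compact embedding `A ↪↪ L^{q(·)}_loc(ℝᴺ)` of a normed function space: `A` is contained in
`L^{q(·)}_loc(ℝᴺ)`, the inclusion is continuous (first two clauses), and every bounded sequence
of `A` has a subsequence that converges in `L^{q(·)}_loc(ℝᴺ)`, that is, with one subsequence and
one limit for all compact sets `K`. -/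
def CompactlyEmbedsLoc {N : ℕ} (A : Set (EuclideanSpace ℝ (Fin N) → ℝ))
    (normA : (EuclideanSpace ℝ (Fin N) → ℝ) → ℝ≥0∞) (q : EuclideanSpace ℝ (Fin N) → ℝ) : Prop :=
  A ⊆ lebesgueLocSpace q ∧
  (∀ K : Set (EuclideanSpace ℝ (Fin N)), IsCompact K →
    ∃ C : ℝ≥0, ∀ u ∈ A, luxemburgNorm (volume.restrict K) q u ≤ C * normA u) ∧
  ∀ u : ℕ → EuclideanSpace ℝ (Fin N) → ℝ, (∀ n, u n ∈ A) →
    (∃ M : ℝ≥0, ∀ n, normA (u n) ≤ M) →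
    ∃ φ : ℕ → ℕ, StrictMono φ ∧ ∃ v ∈ lebesgueLocSpace q,
      ∀ K : Set (EuclideanSpace ℝ (Fin N)), IsCompact K →
        Tendsto (fun n => luxemburgNorm (volume.restrict K) q (u (φ n) - v)) atTop (𝓝 0)

end VarSobolev

/-!
The two embeddings rest on a local Sobolev inequality, for functions with modulars at most `1`, on a
convex set `Q` of diameter at most `1` with a constant exponent `a ≤ p` on `Q × Q` and its critical
exponent `R = N a / (N - s a)` (`lintegral_rpow_le_localConst`). For `x ∈ Q` the copy of `Q`
shrunk towards `x` by a factor `τ` lies in `Q` and has volume `τ^N |Q|`. Averaging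
`|v(x)|^a ≤ 2^a (|v(x)-v(y)|^a + |v(y)|^a)` over `y` in this copy bounds `|v(x)|^a` by
`τ^{sa} (1 + g(x))`, where `g(x)` is the inner Gagliardo integral at `x`, plus the mean of `|v|^a`,
which is controlled by `F = ∫_Q |v|^R`. The best `τ` gives
`|v(x)|^R ≤ C F^{sa/N} (1 + g(x) + |v(x)|^a)`, and integration yields `F ≤ C F^{sa/N}` with
`sa/N < 1`. This bounds `F` when it is finite, in particular for truncations of `v`, and Fatou's
lemma removes the truncation.

For the global embedding, `p` and `r` are nearly constant on the cubes of a fine grid, uniformly in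
the cube, and the gap between `r` and the critical exponent leaves room to choose `a < p` with
`R` above both `p` and `r`. Since `R` is above `p`, scaling turns the local bound into one that is
linear in the modulars of `u` over `Q`, so that the bounds on the cubes add up; and
`|u|^r ≤ |u|^{p(x,x)} + |u|^R` because `p(x,x) ≤ r(x) ≤ R`.

For compactness, a function of the unit ball differs in `L¹` from its mean on a cube of side `h` by
`O(h^s)` in total, so a subsequence along which all cube integrals converge is Cauchy in `L¹_loc`
(`exists_subseq_cauchy`). The local bounds in `L^R` with `R > r` upgrade this by interpolation to
convergence in the modular of `r` (`tendsto_modular_sub`), and Fatou's lemma identifies the limit.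
-/

namespace VarSobolev

/-! ### Modulars and Luxemburg norms -/

section Modular

variable {X : Type*} [MeasurableSpace X] {μ : Measure X} {q : X → ℝ} {u v : X → ℝ}

lemma modular_mono (hq : ∀ x, 0 ≤ q x) (h : ∀ x, |u x| ≤ |v x|) :
    modular μ q u ≤ modular μ q v :=
  lintegral_mono fun x =>
    ENNReal.ofReal_le_ofReal (Real.rpow_le_rpow (abs_nonneg _) (h x) (hq x))

lemma modular_div_le_one_of_luxemburgNorm_lt (hq : ∀ x, 0 ≤ q x) {t : ℝ}
    (h : luxemburgNorm μ q u < ENNReal.ofReal t) : modular μ q (fun x => u x / t) ≤ 1 := by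
  simp only [luxemburgNorm, iInf_lt_iff] at h
  obtain ⟨t', ⟨ht', hm⟩, hlt⟩ := h
  have hlt' : t' < t := (ENNReal.ofReal_lt_ofReal_iff_of_nonneg ht'.le).1 hlt
  refine (modular_mono hq fun x => ?_).trans hm
  rw [abs_div, abs_div, abs_of_pos ht', abs_of_pos (ht'.trans hlt')]
  gcongr

lemma modular_mul_le {c b : ℝ} (hc : 1 ≤ c) (hb : ∀ x, q x ≤ b) :
    modular μ q (fun x => c * u x) ≤ ENNReal.ofReal (c ^ b) * modular μ q u := by
  rw [modular, modular, ← lintegral_const_mul' _ _ ENNReal.ofReal_ne_top]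
  refine lintegral_mono fun x => ?_
  rw [← ENNReal.ofReal_mul (by positivity), abs_mul, abs_of_pos (by positivity : 0 < c),
    Real.mul_rpow (by positivity) (abs_nonneg _)]
  gcongr
  exact hb x

lemma modular_div_le {c : ℝ} (hc : 1 ≤ c) (hq : ∀ x, 1 ≤ q x) :
    modular μ q (fun x => u x / c) ≤ ENNReal.ofReal c⁻¹ * modular μ q u := by
  have hc0 : 0 < c := by positivity
  rw [modular, modular, ← lintegral_const_mul' _ _ ENNReal.ofReal_ne_top]
  refine lintegral_mono fun x => ?_
  rw [← ENNReal.ofReal_mul (by positivity), abs_div, abs_of_pos hc0,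
    Real.div_rpow (abs_nonneg _) hc0.le, div_eq_inv_mul]
  gcongr
  exact Real.self_le_rpow_of_one_le hc (hq x)

lemma luxemburgNorm_le_of_modular_le {C t : ℝ} (hC : 1 ≤ C) (ht : 0 < t) (hq : ∀ x, 1 ≤ q x)
    (h : modular μ q (fun x => u x / t) ≤ ENNReal.ofReal C) :
    luxemburgNorm μ q u ≤ ENNReal.ofReal (C * t) := by
  have hC0 : 0 < C := by positivity
  refine iInf₂_le (C * t) ⟨by positivity, ?_⟩
  have h1 := modular_div_le (μ := μ) (u := fun x => u x / t) hC hq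
  have h2 : (fun x => u x / (C * t)) = fun x => u x / t / C := by
    funext x; rw [div_div, mul_comm]
  rw [h2]
  refine h1.trans ((mul_le_mul_right h _).trans ?_)
  rw [← ENNReal.ofReal_mul (by positivity), inv_mul_cancel₀ hC0.ne', ENNReal.ofReal_one]

lemma luxemburgNorm_lt_top (hq : ∀ x, 1 ≤ q x) (h : modular μ q u < ∞) :
    luxemburgNorm μ q u < ∞ := by
  have h1 : modular μ q (fun x => u x / 1) ≤ ENNReal.ofReal (max 1 (modular μ q u).toReal) := by
    simp only [div_one]
    rw [← ENNReal.ofReal_toReal h.ne]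
    apply ENNReal.ofReal_le_ofReal
    rw [ENNReal.toReal_ofReal ENNReal.toReal_nonneg]
    exact le_max_right _ _
  exact (luxemburgNorm_le_of_modular_le (le_max_left _ _) one_pos hq h1).trans_lt
    ENNReal.ofReal_lt_top

end Modular

/-! ### The Gagliardo modular and the Sobolev norm -/

section Gagliardo

variable {N : ℕ} {s : ℝ} {p : EuclideanSpace ℝ (Fin N) × EuclideanSpace ℝ (Fin N) → ℝ}
  {u : EuclideanSpace ℝ (Fin N) → ℝ}

/-- The integrand `|u(x)-u(y)|^{p(x,y)} / |x-y|^{N+s p(x,y)}` of the Gagliardo modular, with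
values in `[0, ∞]`. -/
noncomputable def gagliardoKernel (s : ℝ)
    (p : EuclideanSpace ℝ (Fin N) × EuclideanSpace ℝ (Fin N) → ℝ)
    (u : EuclideanSpace ℝ (Fin N) → ℝ) (x y : EuclideanSpace ℝ (Fin N)) : ℝ≥0∞ :=
  ENNReal.ofReal (|u x - u y| ^ p (x, y) / ‖x - y‖ ^ ((N : ℝ) + s * p (x, y)))

lemma gagliardoModular_one :
    gagliardoModular s p u 1 = ∫⁻ y, ∫⁻ x, gagliardoKernel s p u x y := by
  simp [gagliardoModular, gagliardoKernel]

lemma gagliardoKernel_div {t : ℝ} (ht : 0 < t) (x y : EuclideanSpace ℝ (Fin N)) :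
    gagliardoKernel s p (fun x => u x / t) x y = ENNReal.ofReal
      (|u x - u y| ^ p (x, y) / (t ^ p (x, y) * ‖x - y‖ ^ ((N : ℝ) + s * p (x, y)))) := by
  rw [gagliardoKernel, ← sub_div, abs_div, abs_of_pos ht, Real.div_rpow (abs_nonneg _) ht.le,
    div_div]

lemma gagliardoModular_div {t : ℝ} (ht : 0 < t) :
    gagliardoModular s p (fun x => u x / t) 1 = gagliardoModular s p u t := by
  rw [gagliardoModular_one]
  simp only [gagliardoKernel_div ht, gagliardoModular]

lemma gagliardoModular_le_one_of_seminorm_lt (hp : ∀ z, 0 ≤ p z) {t : ℝ}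
    (h : gagliardoSeminorm s p u < ENNReal.ofReal t) : gagliardoModular s p u t ≤ 1 := by
  simp only [gagliardoSeminorm, iInf_lt_iff] at h
  obtain ⟨t', ⟨ht', hm⟩, hlt⟩ := h
  have hlt' : t' < t := (ENNReal.ofReal_lt_ofReal_iff_of_nonneg ht'.le).1 hlt
  refine le_trans ?_ hm.le
  rw [← gagliardoModular_div (ht'.trans hlt'), ← gagliardoModular_div ht', gagliardoModular_one,
    gagliardoModular_one]
  refine lintegral_mono fun y => lintegral_mono fun x => ENNReal.ofReal_le_ofReal ?_
  have h1 : |u x / t - u y / t| ≤ |u x / t' - u y / t'| := by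
    rw [← sub_div, ← sub_div, abs_div, abs_div, abs_of_pos ht', abs_of_pos (ht'.trans hlt')]
    gcongr
  have := hp (x, y)
  gcongr

lemma gagliardoSeminorm_lt_top (hp : ∀ z, 1 ≤ p z) (h : gagliardoModular s p u 1 < ∞) :
    gagliardoSeminorm s p u < ∞ := by
  set c : ℝ := (gagliardoModular s p u 1).toReal + 1 with hc
  have hc1 : 1 ≤ c := by rw [hc]; linarith [ENNReal.toReal_nonneg (a := gagliardoModular s p u 1)]
  have hc0 : 0 < c := by positivity
  refine (iInf₂_le c ⟨hc0, ?_⟩).trans_lt ENNReal.ofReal_lt_top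
  have h1 : gagliardoModular s p u c ≤ ENNReal.ofReal c⁻¹ * gagliardoModular s p u 1 := by
    rw [gagliardoModular, gagliardoModular_one, ← lintegral_const_mul' _ _ ENNReal.ofReal_ne_top]
    refine lintegral_mono fun y => ?_
    rw [← lintegral_const_mul' _ _ ENNReal.ofReal_ne_top]
    refine lintegral_mono fun x => ?_
    rw [gagliardoKernel, ← ENNReal.ofReal_mul (by positivity)]
    apply ENNReal.ofReal_le_ofReal
    rw [mul_comm (c ^ _), ← div_div, div_eq_inv_mul]
    gcongr
    exact Real.self_le_rpow_of_one_le hc1 (hp _)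
  refine h1.trans_lt ?_
  rw [← ENNReal.ofReal_toReal h.ne, ← ENNReal.ofReal_mul (by positivity), ← ENNReal.ofReal_one,
    ENNReal.ofReal_lt_ofReal_iff one_pos, inv_mul_lt_iff₀ hc0]
  linarith

lemma sobolevNorm_lt_top (hp : ∀ z, 1 ≤ p z) (hu : u ∈ sobolevSpace s p) :
    sobolevNorm s p u < ∞ :=
  ENNReal.add_lt_top.2 ⟨luxemburgNorm_lt_top (fun _ => hp _) hu.1.2,
    gagliardoSeminorm_lt_top hp hu.2⟩

/-- A function of Sobolev norm below `t` becomes, after division by `t`, a function both of whose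
modulars are at most `1`. -/
lemma modular_div_le_one_of_sobolevNorm_lt (hp : ∀ z, 0 ≤ p z) {t : ℝ} (ht : 0 < t)
    (h : sobolevNorm s p u < ENNReal.ofReal t) :
    modular volume (fun x => p (x, x)) (fun x => u x / t) ≤ 1 ∧
      gagliardoModular s p (fun x => u x / t) 1 ≤ 1 :=
  ⟨modular_div_le_one_of_luxemburgNorm_lt (fun _ => hp _) (le_self_add.trans_lt h),
    (gagliardoModular_div ht).trans_le
      (gagliardoModular_le_one_of_seminorm_lt hp (le_add_self.trans_lt h))⟩

end Gagliardo

/-! ### Real inequalities -/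

section RealInequalities

lemma rpow_abs_le_two_rpow {a x y : ℝ} (ha : 0 ≤ a) :
    |x| ^ a ≤ 2 ^ a * (|x - y| ^ a + |y| ^ a) := by
  have h1 : |x| ≤ 2 * max |x - y| |y| := by
    have h2 : |x| ≤ |x - y| + |y| := by simpa using abs_add_le (x - y) y
    linarith [le_max_left |x - y| |y|, le_max_right |x - y| |y|]
  have h0 : 0 ≤ max |x - y| |y| := le_max_of_le_left (abs_nonneg _)
  calc |x| ^ a ≤ (2 * max |x - y| |y|) ^ a := Real.rpow_le_rpow (abs_nonneg _) h1 ha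
    _ = 2 ^ a * (max |x - y| |y|) ^ a := Real.mul_rpow (by norm_num) h0
    _ ≤ _ := by
      gcongr
      rcases max_choice |x - y| |y| with h | h <;> rw [h]
      · linarith [Real.rpow_nonneg (abs_nonneg y) a]
      · linarith [Real.rpow_nonneg (abs_nonneg (x - y)) a]

lemma rpow_le_add_rpow {x a b c : ℝ} (hx : 0 ≤ x) (hab : a ≤ b) (hbc : b ≤ c) (ha : 0 < a) :
    x ^ b ≤ x ^ a + x ^ c := by
  rcases hx.eq_or_lt with rfl | hx
  · rw [Real.zero_rpow (ha.trans_le hab).ne', Real.zero_rpow ha.ne',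
      Real.zero_rpow (ha.trans_le (hab.trans hbc)).ne', add_zero]
  rcases le_total x 1 with h | h
  · linarith [Real.rpow_le_rpow_of_exponent_ge hx h hab, Real.rpow_nonneg hx.le c]
  · linarith [Real.rpow_le_rpow_of_exponent_le h hbc, Real.rpow_nonneg hx.le a]

lemma rpow_le_one_add_rpow {x a b : ℝ} (hx : 0 ≤ x) (ha : 0 ≤ a) (hab : a ≤ b) :
    x ^ a ≤ 1 + x ^ b := by
  rcases le_total x 1 with h | h
  · linarith [Real.rpow_le_one hx h ha, Real.rpow_nonneg hx b]
  · linarith [Real.rpow_le_rpow_of_exponent_le h hab]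

/-- A difference raised to a power at most `P` is controlled by the Gagliardo integrand with
exponent `P`, at the cost of an additive term that is small when `d` is. -/
lemma rpow_le_rpow_mul_one_add {w d s a P n : ℝ} (hw : 0 ≤ w) (hd : 0 ≤ d) (ha : 0 < a)
    (haP : a ≤ P) (hwd : d = 0 → w = 0) :
    w ^ a ≤ d ^ (s * a) * (1 + d ^ n * (w ^ P / d ^ (n + s * P))) := by
  rcases hd.eq_or_lt with h | hd
  · rw [hwd h.symm, Real.zero_rpow ha.ne', Real.zero_rpow (ha.trans_le haP).ne']
    simp only [zero_div, mul_zero, add_zero, mul_one]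
    positivity
  · have h1 : w = d ^ s * (w / d ^ s) := by field_simp
    have h2 : d ^ n * (w ^ P / d ^ (n + s * P)) = (w / d ^ s) ^ P := by
      rw [Real.rpow_add hd, Real.div_rpow hw (by positivity), ← Real.rpow_mul hd.le]
      field_simp
    have h3 : w ^ a = d ^ (s * a) * (w / d ^ s) ^ a := by
      conv_lhs => rw [h1]
      rw [Real.mul_rpow (by positivity) (by positivity), ← Real.rpow_mul hd.le]
    rw [h2, h3]
    gcongr
    exact rpow_le_one_add_rpow (by positivity) ha.le haP

/-- Optimization of the averaging inequality `h` in the scale `τ` and the level `M`. -/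
lemma rpow_le_of_forall_scale {X V F g a s R n : ℝ} (hX : 0 ≤ X) (hV : 0 < V) (hF : 0 < F)
    (hg : 0 ≤ g) (hn : 0 < n) (ha : 1 ≤ a) (hs : 0 < s) (haR : a ≤ R)
    (hR : R = a + R * (s * a / n))
    (h : ∀ τ M : ℝ, 0 < τ → τ ≤ 1 → 0 < M → X ^ a * (τ ^ n * V) ≤
      2 ^ a * (τ ^ (s * a) * (τ ^ n * (V + g)) + M ^ a * (τ ^ n * V) + M ^ (a - R) * F)) :
    X ^ R ≤ (4 ^ (R + 1) * F / V) ^ (s * a / n) * (2 ^ (a + 2) * (1 + g / V) + X ^ a) := by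
  have hθ : 0 < s * a / n := by positivity
  set θ := s * a / n with hθd
  rcases hX.eq_or_lt with hX0 | hX
  · rw [← hX0, Real.zero_rpow (by linarith : R ≠ 0)]
    positivity
  have hXR : X ^ R = X ^ a * (X ^ R) ^ θ := by
    rw [← Real.rpow_mul hX.le, ← Real.rpow_add hX, ← hR]
  set L := 4 ^ (R + 1) * F / V with hL
  have hL0 : 0 < L := by positivity
  rcases le_total L (X ^ R) with hc | hc
  · -- `σ = τ^n` is chosen so that the level term is at most a quarter of the left-hand side, and
    -- the level `M = X / 4` so that the term with `M ^ a` is at most half of it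
    set σ := L / X ^ R with hσ
    have hσ0 : 0 < σ := by positivity
    have hσ1 : σ ≤ 1 := by rw [hσ, div_le_one (by positivity)]; exact hc
    have hτ := h (σ ^ (1 / n)) (X / 4) (by positivity)
      (Real.rpow_le_one hσ0.le hσ1 (by positivity)) (by positivity)
    rw [← Real.rpow_mul hσ0.le, ← Real.rpow_mul hσ0.le] at hτ
    have e1 : 1 / n * n = 1 := by field_simp
    have e2 : 1 / n * (s * a) = θ := by rw [hθd]; ring
    rw [e1, e2, Real.rpow_one] at hτ
    have h1 : (2 : ℝ) ^ a * (X / 4) ^ a ≤ X ^ a / 2 := by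
      rw [← Real.mul_rpow (by norm_num) (by positivity), show 2 * (X / 4) = X / 2 by ring,
        Real.div_rpow hX.le (by norm_num)]
      gcongr
      exact Real.self_le_rpow_of_one_le (by norm_num) ha
    have h2 : (2 : ℝ) ^ a * (X / 4) ^ (a - R) * F ≤ X ^ a * (σ * V) / 4 := by
      have h3 : (X / 4) ^ (a - R) = X ^ a / X ^ R * (4 ^ R / 4 ^ a) := by
        rw [Real.div_rpow hX.le (by norm_num), Real.rpow_sub hX, Real.rpow_sub (by norm_num)]
        field_simp
      have h4 : X ^ a * (σ * V) / 4 = X ^ a / X ^ R * 4 ^ R * F := by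
        rw [hσ, hL, Real.rpow_add (by norm_num), Real.rpow_one]
        field_simp
      have h5 : (2 : ℝ) ^ a / 4 ^ a ≤ 1 := by
        rw [div_le_one (by positivity)]
        exact Real.rpow_le_rpow (by norm_num) (by norm_num) (by linarith)
      rw [h3, h4]
      calc (2 : ℝ) ^ a * (X ^ a / X ^ R * (4 ^ R / 4 ^ a)) * F
          = (X ^ a / X ^ R * 4 ^ R * F) * (2 ^ a / 4 ^ a) := by field_simp
        _ ≤ (X ^ a / X ^ R * 4 ^ R * F) * 1 := by gcongr
        _ = _ := mul_one _
    have h6 : X ^ a * (σ * V) ≤ 2 ^ a * σ ^ θ * σ * (V + g) + X ^ a * (σ * V) / 2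
        + X ^ a * (σ * V) / 4 := by
      have h7 : (2 : ℝ) ^ a * (X / 4) ^ a * (σ * V) ≤ X ^ a / 2 * (σ * V) := by gcongr
      nlinarith [hτ, h7, h2]
    have h8 : X ^ a ≤ 2 ^ (a + 2) * σ ^ θ * (1 + g / V) := by
      rw [Real.rpow_add (by norm_num)]
      have h9 : (X ^ a) * (σ * V) ≤ (2 ^ a * 4 * σ ^ θ * (1 + g / V)) * (σ * V) := by
        have h10 : (2 ^ a * 4 * σ ^ θ * (1 + g / V)) * (σ * V)
            = 4 * (2 ^ a * σ ^ θ * σ * (V + g)) := by field_simp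
        rw [h10]; linarith
      have := le_of_mul_le_mul_right h9 (by positivity)
      norm_num at this ⊢
      exact this
    calc X ^ R = X ^ a * (X ^ R) ^ θ := hXR
      _ ≤ 2 ^ (a + 2) * σ ^ θ * (1 + g / V) * (X ^ R) ^ θ := by gcongr
      _ = L ^ θ * (2 ^ (a + 2) * (1 + g / V)) := by
        have : L = σ * X ^ R := by rw [hσ]; field_simp
        rw [this, Real.mul_rpow hσ0.le (by positivity)]; ring
      _ ≤ _ := by
        gcongr
        linarith [Real.rpow_nonneg hX.le a]
  · -- here the optimal scale would exceed `1`, but `X` itself is small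
    calc X ^ R = X ^ a * (X ^ R) ^ θ := hXR
      _ ≤ X ^ a * L ^ θ := by gcongr
      _ ≤ _ := by
        rw [mul_comm]
        gcongr
        have : 0 ≤ 2 ^ (a + 2) * (1 + g / V) := by positivity
        linarith

/-- The constant of the local Sobolev inequality on a convex set of volume `V`, for integrability
exponents up to `R₀`. -/
noncomputable def localConst (V R₀ : ℝ) : ℝ :=
  (4 ^ (R₀ + 1) * (1 + 1 / V) * (2 ^ (R₀ + 2) * (V + 1 / V) + V + 1)) ^ R₀

/-- A self-improving inequality `F ≤ B F^θ` with `θ < 1` bounds `F`. -/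
lemma le_localConst {V F a s R R₀ n : ℝ} (hV : 0 < V) (hF : 0 < F)
    (hn : 0 < n) (ha : 1 ≤ a) (hs : 0 < s) (hsn : s * a < n) (haR : a ≤ R) (hRR : R ≤ R₀)
    (hR : R = a + R * (s * a / n))
    (h : F ≤ (4 ^ (R + 1) * F / V) ^ (s * a / n) *
      (2 ^ (a + 2) * (V + 1 / V) + (V + 1))) : F ≤ localConst V R₀ := by
  have hθ : 0 < s * a / n := by positivity
  have hθ1 : s * a / n < 1 := by rwa [div_lt_one hn]
  set θ := s * a / n
  set H := 2 ^ (R₀ + 2) * (V + 1 / V) + V + 1 with hH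
  set c := (4 : ℝ) ^ (R₀ + 1) * (1 + 1 / V) with hc
  have hc1 : 1 ≤ c := by
    rw [hc]
    have h1 : (1 : ℝ) ≤ 4 ^ (R₀ + 1) := Real.one_le_rpow (by norm_num) (by linarith)
    have h2 : (1 : ℝ) ≤ 1 + 1 / V := by
      have : 0 < 1 / V := by positivity
      linarith
    nlinarith
  have hH1 : 1 ≤ H := by
    have : 0 ≤ 2 ^ (R₀ + 2) * (V + 1 / V) := by positivity
    rw [hH]; linarith
  have h1 : F ≤ c * H * F ^ θ := by
    calc F ≤ _ := h
      _ ≤ (c * F) ^ θ * H := by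
        have e : 4 ^ (R + 1) * F / V = 4 ^ (R + 1) * (1 / V) * F := by ring
        rw [e, hH, add_assoc]
        have h2 : 1 / V ≤ 1 + 1 / V := by linarith
        rw [hc]
        gcongr
        · norm_num
        · norm_num
        · linarith
      _ = c ^ θ * F ^ θ * H := by rw [Real.mul_rpow (by positivity) hF.le]
      _ ≤ c * F ^ θ * H := by
        gcongr
        exact Real.rpow_le_self_of_one_le hc1 hθ1.le
      _ = _ := by ring
  have h2 : F ^ (1 - θ) ≤ c * H := by
    rw [Real.rpow_sub hF, Real.rpow_one, div_le_iff₀ (by positivity)]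
    exact h1
  have h3 : (1 - θ) * (R / a) = 1 := by
    have : R * (1 - θ) = a := by linarith
    field_simp
    linarith
  have hcH : 1 ≤ c * H := by nlinarith
  calc F = (F ^ (1 - θ)) ^ (R / a) := by rw [← Real.rpow_mul hF.le, h3, Real.rpow_one]
    _ ≤ (c * H) ^ (R / a) :=
      Real.rpow_le_rpow (by positivity) h2 (div_nonneg (by linarith) (by linarith))
    _ ≤ (c * H) ^ R₀ := by
      apply Real.rpow_le_rpow_of_exponent_le hcH
      exact (div_le_self (by linarith) ha).trans hRR

lemma one_le_localConst {V R₀ : ℝ} (hV : 0 < V) (hR : 0 ≤ R₀) : 1 ≤ localConst V R₀ := by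
  apply Real.one_le_rpow _ hR
  have h1 : (1 : ℝ) ≤ 4 ^ (R₀ + 1) := Real.one_le_rpow (by norm_num) (by linarith)
  have h2 : 0 < 1 / V := by positivity
  have h3 : 0 ≤ 2 ^ (R₀ + 2) * (V + 1 / V) := by positivity
  have h4 : 1 ≤ 4 ^ (R₀ + 1) * (1 + 1 / V) := by nlinarith
  nlinarith

end RealInequalities

/-! ### The local Sobolev inequality with a constant exponent -/

section Local

variable {N : ℕ} {Q : Set (EuclideanSpace ℝ (Fin N))} {V : ℝ}

/-- The averaging inequality at a point `x` of a convex set `Q`, over the copy of `Q` shrunk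
towards `x` by the factor `τ`. -/
lemma averaging_le (hQc : Convex ℝ Q) (hQm : MeasurableSet Q)
    (hQd : ∀ x ∈ Q, ∀ y ∈ Q, ‖x - y‖ ≤ 1) (hV : 0 < V) (hvol : volume Q = ENNReal.ofReal V)
    {v : EuclideanSpace ℝ (Fin N) → ℝ} (hv : AEMeasurable v (volume.restrict Q)) {a s R : ℝ}
    (ha : 1 ≤ a) (hs : 0 < s) (haR : a ≤ R) {x : EuclideanSpace ℝ (Fin N)} (hx : x ∈ Q)
    {G : EuclideanSpace ℝ (Fin N) → ℝ≥0∞}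
    (hG : ∀ y ∈ Q, ENNReal.ofReal (|v x - v y| ^ a) ≤
      ENNReal.ofReal (‖x - y‖ ^ (s * a)) * (1 + ENNReal.ofReal (‖x - y‖ ^ (N : ℝ)) * G y))
    {F : ℝ} (hF : 0 ≤ F) (hFv : ∫⁻ y in Q, ENNReal.ofReal (|v y| ^ R) ≤ ENNReal.ofReal F)
    {g : ℝ} (hg0 : 0 ≤ g) (hg : ∫⁻ y in Q, G y ≤ ENNReal.ofReal g)
    {τ M : ℝ} (hτ : 0 < τ) (hτ1 : τ ≤ 1) (hM : 0 < M) :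
    |v x| ^ a * (τ ^ (N : ℝ) * V) ≤
      2 ^ a * (τ ^ (s * a) * (τ ^ (N : ℝ) * (V + g)) + M ^ a * (τ ^ (N : ℝ) * V)
        + M ^ (a - R) * F) := by
  set S := AffineMap.homothety x τ '' Q with hS
  have hSQ : S ⊆ Q := by
    rintro _ ⟨y, hy, rfl⟩
    exact hQc.lineMap_mem hx hy ⟨hτ.le, hτ1⟩
  have hSd : ∀ y ∈ S, ‖x - y‖ ≤ τ := by
    rintro _ ⟨y, hy, rfl⟩
    rw [AffineMap.homothety_apply]
    simp only [vsub_eq_sub, vadd_eq_add, sub_add_cancel_right, norm_neg, norm_smul,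
      Real.norm_eq_abs, abs_of_pos hτ]
    have := hQd y hy x hx
    nlinarith
  have hSm : MeasurableSet S := by
    have h1 : S = AffineMap.homothety x τ⁻¹ ⁻¹' Q := by
      ext z
      simp only [hS, Set.mem_image, Set.mem_preimage]
      constructor
      · rintro ⟨y, hy, rfl⟩
        simpa [AffineMap.homothety_apply, hτ.ne'] using hy
      · intro hz
        exact ⟨_, hz, by simp [AffineMap.homothety_apply, hτ.ne']⟩
    rw [h1]
    exact (AffineMap.homothety_continuous x τ⁻¹).measurable hQm
  have hSvol : volume S = ENNReal.ofReal (τ ^ (N : ℝ) * V) := by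
    rw [hS, Measure.addHaar_image_homothety, hvol, ← ENNReal.ofReal_mul (abs_nonneg _),
      finrank_euclideanSpace_fin, abs_of_pos (by positivity), Real.rpow_natCast]
  have hmono : volume.restrict S ≤ volume.restrict Q := Measure.restrict_mono hSQ le_rfl
  have hvS : AEMeasurable v (volume.restrict S) := hv.mono_measure hmono
  have hpt : ∀ y ∈ S, ENNReal.ofReal (|v x| ^ a) ≤ ENNReal.ofReal (2 ^ a) *
      (ENNReal.ofReal (M ^ (a - R)) * ENNReal.ofReal (|v y| ^ R) +
      (ENNReal.ofReal (τ ^ (s * a) + M ^ a) +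
        ENNReal.ofReal (τ ^ (s * a) * τ ^ (N : ℝ)) * G y)) := by
    intro y hy
    have h1 := rpow_abs_le_two_rpow (x := v x) (y := v y) (a := a) (by linarith)
    have h2 : |v y| ^ a ≤ M ^ a + M ^ (a - R) * |v y| ^ R := by
      rcases le_total |v y| M with h | h
      · have : |v y| ^ a ≤ M ^ a := Real.rpow_le_rpow (abs_nonneg _) h (by linarith)
        have : 0 ≤ M ^ (a - R) * |v y| ^ R := by positivity
        linarith
      · have hpos : 0 < |v y| := hM.trans_le h
        have h3 : |v y| ^ a = |v y| ^ (a - R) * |v y| ^ R := by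
          rw [← Real.rpow_add hpos, sub_add_cancel]
        have h4 : |v y| ^ (a - R) ≤ M ^ (a - R) :=
          Real.rpow_le_rpow_of_nonpos hM h (by linarith)
        have h5 : |v y| ^ (a - R) * |v y| ^ R ≤ M ^ (a - R) * |v y| ^ R := by gcongr
        have : 0 ≤ M ^ a := by positivity
        linarith
    have h3 : ENNReal.ofReal (|v x - v y| ^ a) ≤ ENNReal.ofReal (τ ^ (s * a)) +
        ENNReal.ofReal (τ ^ (s * a) * τ ^ (N : ℝ)) * G y := by
      refine (hG y (hSQ hy)).trans ?_
      rw [mul_add, mul_one, ← mul_assoc, ← ENNReal.ofReal_mul (by positivity)]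
      have := hSd y hy
      gcongr
    calc ENNReal.ofReal (|v x| ^ a)
        ≤ ENNReal.ofReal (2 ^ a * (|v x - v y| ^ a + (M ^ a + M ^ (a - R) * |v y| ^ R))) :=
          ENNReal.ofReal_le_ofReal (h1.trans (by gcongr))
      _ = ENNReal.ofReal (2 ^ a) * (ENNReal.ofReal (|v x - v y| ^ a) + (ENNReal.ofReal (M ^ a)
            + ENNReal.ofReal (M ^ (a - R)) * ENNReal.ofReal (|v y| ^ R))) := by
          rw [ENNReal.ofReal_mul (by positivity), ENNReal.ofReal_add (by positivity) (by positivity),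
            ENNReal.ofReal_add (by positivity) (by positivity), ENNReal.ofReal_mul (by positivity)]
      _ ≤ ENNReal.ofReal (2 ^ a) * ((ENNReal.ofReal (τ ^ (s * a)) +
            ENNReal.ofReal (τ ^ (s * a) * τ ^ (N : ℝ)) * G y) + (ENNReal.ofReal (M ^ a)
            + ENNReal.ofReal (M ^ (a - R)) * ENNReal.ofReal (|v y| ^ R))) := by gcongr
      _ = _ := by
          rw [ENNReal.ofReal_add (by positivity) (by positivity)]
          congr 1
          abel
  have hint : ENNReal.ofReal (|v x| ^ a) * volume S ≤ ENNReal.ofReal (2 ^ a) *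
      (ENNReal.ofReal (M ^ (a - R)) * ENNReal.ofReal F +
      (ENNReal.ofReal (τ ^ (s * a) + M ^ a) * volume S +
        ENNReal.ofReal (τ ^ (s * a) * τ ^ (N : ℝ)) * ENNReal.ofReal g)) := by
    rw [← setLIntegral_const]
    refine (setLIntegral_mono' hSm hpt).trans ?_
    rw [lintegral_const_mul' _ _ ENNReal.ofReal_ne_top]
    gcongr
    rw [lintegral_add_left' (by fun_prop), lintegral_add_left' (by fun_prop),
      lintegral_const_mul' _ _ ENNReal.ofReal_ne_top,
      lintegral_const_mul' _ _ ENNReal.ofReal_ne_top, setLIntegral_const]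
    gcongr
    · exact (lintegral_mono' hmono le_rfl).trans hFv
    · exact (lintegral_mono' hmono le_rfl).trans hg
  rw [hSvol, ← ENNReal.ofReal_mul (by positivity), ← ENNReal.ofReal_mul (by positivity),
    ← ENNReal.ofReal_mul (by positivity), ← ENNReal.ofReal_mul (by positivity),
    ← ENNReal.ofReal_add (by positivity) (by positivity),
    ← ENNReal.ofReal_add (by positivity) (by positivity), ← ENNReal.ofReal_mul (by positivity),
    ENNReal.ofReal_le_ofReal_iff (by positivity)] at hint
  refine hint.trans (le_of_eq ?_)
  ring

/-- The local Sobolev inequality for bounded functions: boundedness makes the integral on the left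
finite, so that the self-improving inequality for it can be resolved. -/
lemma lintegral_rpow_le_of_bounded (hN : 0 < N) (hQc : Convex ℝ Q) (hQm : MeasurableSet Q)
    (hQd : ∀ x ∈ Q, ∀ y ∈ Q, ‖x - y‖ ≤ 1) (hV : 0 < V) (hvol : volume Q = ENNReal.ofReal V)
    {v : EuclideanSpace ℝ (Fin N) → ℝ} (hv : AEMeasurable v (volume.restrict Q))
    {T : ℝ} (hT : ∀ x, |v x| ≤ T) {a s R R₀ : ℝ}
    (ha : 1 ≤ a) (hs : 0 < s) (hsa : s * a < N) (hR : R * (N - s * a) = N * a) (hRR : R ≤ R₀)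
    {G : EuclideanSpace ℝ (Fin N) → EuclideanSpace ℝ (Fin N) → ℝ≥0∞}
    (hG : ∀ x ∈ Q, ∀ y ∈ Q, ENNReal.ofReal (|v x - v y| ^ a) ≤
      ENNReal.ofReal (‖x - y‖ ^ (s * a)) * (1 + ENNReal.ofReal (‖x - y‖ ^ (N : ℝ)) * G x y))
    (hG1 : ∫⁻ x in Q, ∫⁻ y in Q, G x y ≤ 1)
    (hva : ∫⁻ x in Q, ENNReal.ofReal (|v x| ^ a) ≤ ENNReal.ofReal (V + 1)) :
    ∫⁻ x in Q, ENNReal.ofReal (|v x| ^ R) ≤ ENNReal.ofReal (localConst V R₀) := by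
  have hn : (0 : ℝ) < N := by exact_mod_cast hN
  have hR' : R = a + R * (s * a / N) := by field_simp; linarith
  have hR0 : 0 < R := by
    have h1 : 0 < R * (N - s * a) := by rw [hR]; positivity
    exact pos_of_mul_pos_left h1 (by linarith)
  have haR : a ≤ R := by
    have : 0 ≤ R * (s * a / N) := by positivity
    linarith
  set I := ∫⁻ x in Q, ENNReal.ofReal (|v x| ^ R) with hI
  have hIfin : I ≠ ∞ := by
    have h1 : I ≤ ENNReal.ofReal (T ^ R) * volume Q := by
      rw [← setLIntegral_const]
      exact lintegral_mono fun x => ENNReal.ofReal_le_ofReal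
        (Real.rpow_le_rpow (abs_nonneg _) (hT x) hR0.le)
    rw [hvol] at h1
    exact (h1.trans_lt (ENNReal.mul_lt_top ENNReal.ofReal_lt_top ENNReal.ofReal_lt_top)).ne
  set F := I.toReal with hF
  have hIF : I = ENNReal.ofReal F := (ENNReal.ofReal_toReal hIfin).symm
  have hF0 : 0 ≤ F := ENNReal.toReal_nonneg
  rcases hF0.eq_or_lt with hFz | hFpos
  · rw [hIF, ← hFz, ENNReal.ofReal_zero]
    exact zero_le
  rw [hIF]
  apply ENNReal.ofReal_le_ofReal
  refine le_localConst hV hFpos hn ha hs hsa haR hRR hR' ?_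
  set c := (4 ^ (R + 1) * F / V) ^ (s * a / N) with hc
  have hc0 : 0 < c := by positivity
  have hpt : ∀ x ∈ Q, ENNReal.ofReal (|v x| ^ R) ≤ ENNReal.ofReal c *
      ((ENNReal.ofReal (2 ^ (a + 2)) + ENNReal.ofReal (|v x| ^ a)) +
        ENNReal.ofReal (2 ^ (a + 2) / V) * ∫⁻ y in Q, G x y) := by
    intro x hx
    by_cases hgt : ∫⁻ y in Q, G x y = ∞
    · -- `G` is not assumed measurable, so this case cannot be excluded almost everywhere
      have h1 : ENNReal.ofReal (2 ^ (a + 2) / V) ≠ 0 := by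
        rw [Ne, ENNReal.ofReal_eq_zero, not_le]; positivity
      have h2 : ENNReal.ofReal c ≠ 0 := by
        rw [Ne, ENNReal.ofReal_eq_zero, not_le]; positivity
      rw [hgt, ENNReal.mul_top h1, add_top, ENNReal.mul_top h2]
      exact le_top
    · set g := (∫⁻ y in Q, G x y).toReal with hg
      have hg0 : 0 ≤ g := ENNReal.toReal_nonneg
      have hgg : ∫⁻ y in Q, G x y = ENNReal.ofReal g := (ENNReal.ofReal_toReal hgt).symm
      have h1 := rpow_le_of_forall_scale (abs_nonneg (v x)) hV hFpos hg0 hn ha hs haR hR'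
        (fun τ M hτ hτ1 hM => averaging_le hQc hQm hQd hV hvol hv ha hs haR hx (hG x hx) hF0
          hIF.le hg0 hgg.le hτ hτ1 hM)
      rw [hgg, ← ENNReal.ofReal_mul (by positivity), ← ENNReal.ofReal_add (by positivity)
        (by positivity), ← ENNReal.ofReal_add (by positivity) (by positivity),
        ← ENNReal.ofReal_mul (by positivity)]
      refine ENNReal.ofReal_le_ofReal (h1.trans (le_of_eq ?_))
      ring
  have hint : ENNReal.ofReal F ≤ ENNReal.ofReal c *
      ((ENNReal.ofReal (2 ^ (a + 2)) * ENNReal.ofReal V + ENNReal.ofReal (V + 1)) +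
        ENNReal.ofReal (2 ^ (a + 2) / V) * 1) := by
    rw [← hIF, hI]
    refine (setLIntegral_mono' hQm hpt).trans ?_
    rw [lintegral_const_mul' _ _ ENNReal.ofReal_ne_top, lintegral_add_left' (by fun_prop),
      lintegral_add_left' (by fun_prop), lintegral_const_mul' _ _ ENNReal.ofReal_ne_top,
      setLIntegral_const, hvol]
    gcongr
  rw [mul_one, ← ENNReal.ofReal_mul (by positivity), ← ENNReal.ofReal_add (by positivity)
    (by positivity), ← ENNReal.ofReal_add (by positivity) (by positivity),
    ← ENNReal.ofReal_mul (by positivity), ENNReal.ofReal_le_ofReal_iff (by positivity)] at hint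
  refine hint.trans (le_of_eq ?_)
  ring

lemma abs_truncate_le (T x : ℝ) (hT : 0 ≤ T) : |max (-T) (min x T)| ≤ T := by
  rw [abs_le]
  exact ⟨le_max_left _ _, max_le (by linarith) (min_le_right _ _)⟩

lemma abs_truncate_le_abs (T x : ℝ) (hT : 0 ≤ T) : |max (-T) (min x T)| ≤ |x| := by
  rcases max_cases (-T) (min x T) with h | h <;> rcases min_cases x T with h' | h' <;>
    rcases abs_cases x with h'' | h'' <;> rw [h.1] <;> try rw [h'.1]
  all_goals rw [abs_le]; constructor <;> linarith

lemma abs_truncate_sub_le (T x y : ℝ) :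
    |max (-T) (min x T) - max (-T) (min y T)| ≤ |x - y| := by
  refine (abs_max_sub_max_le_max _ _ _ _).trans (max_le (by simp) ?_)
  exact (abs_min_sub_min_le_max _ _ _ _).trans (max_le le_rfl (by simp))

/-- The local Sobolev inequality on a convex set with a constant exponent `a` and its critical
exponent `R = N a / (N - s a)`, in inhomogeneous form. -/
lemma lintegral_rpow_le_localConst (hN : 0 < N) (hQc : Convex ℝ Q) (hQm : MeasurableSet Q)
    (hQd : ∀ x ∈ Q, ∀ y ∈ Q, ‖x - y‖ ≤ 1) (hV : 0 < V) (hvol : volume Q = ENNReal.ofReal V)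
    {v : EuclideanSpace ℝ (Fin N) → ℝ} (hv : AEMeasurable v (volume.restrict Q))
    {a s R R₀ : ℝ}
    (ha : 1 ≤ a) (hs : 0 < s) (hsa : s * a < N) (hR : R * (N - s * a) = N * a) (hRR : R ≤ R₀)
    {G : EuclideanSpace ℝ (Fin N) → EuclideanSpace ℝ (Fin N) → ℝ≥0∞}
    (hG : ∀ x ∈ Q, ∀ y ∈ Q, ENNReal.ofReal (|v x - v y| ^ a) ≤
      ENNReal.ofReal (‖x - y‖ ^ (s * a)) * (1 + ENNReal.ofReal (‖x - y‖ ^ (N : ℝ)) * G x y))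
    (hG1 : ∫⁻ x in Q, ∫⁻ y in Q, G x y ≤ 1)
    (hva : ∫⁻ x in Q, ENNReal.ofReal (|v x| ^ a) ≤ ENNReal.ofReal (V + 1)) :
    ∫⁻ x in Q, ENNReal.ofReal (|v x| ^ R) ≤ ENNReal.ofReal (localConst V R₀) := by
  have hR0 : 0 ≤ R := by
    have h1 : 0 ≤ R * (N - s * a) := by rw [hR]; positivity
    exact nonneg_of_mul_nonneg_left h1 (by linarith)
  set w : ℕ → EuclideanSpace ℝ (Fin N) → ℝ := fun n x => max (-(n : ℝ)) (min (v x) n) with hw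
  have hwm : ∀ n, AEMeasurable (w n) (volume.restrict Q) := fun n => by
    simp only [hw]; fun_prop
  have hbound : ∀ n, ∫⁻ x in Q, ENNReal.ofReal (|w n x| ^ R) ≤
      ENNReal.ofReal (localConst V R₀) := by
    intro n
    refine lintegral_rpow_le_of_bounded hN hQc hQm hQd hV hvol (hwm n)
      (fun x => abs_truncate_le n (v x) n.cast_nonneg) ha hs hsa hR hRR
      (fun x hx y hy => ?_) hG1 (le_trans ?_ hva)
    · refine (ENNReal.ofReal_le_ofReal ?_).trans (hG x hx y hy)
      exact Real.rpow_le_rpow (abs_nonneg _) (abs_truncate_sub_le _ _ _) (by linarith)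
    · refine lintegral_mono fun x => ENNReal.ofReal_le_ofReal ?_
      exact Real.rpow_le_rpow (abs_nonneg _) (abs_truncate_le_abs _ _ n.cast_nonneg) (by linarith)
  have hlim : ∀ x, liminf (fun n => ENNReal.ofReal (|w n x| ^ R)) atTop =
      ENNReal.ofReal (|v x| ^ R) := by
    intro x
    refine (tendsto_const_nhds.congr' ?_).liminf_eq
    filter_upwards [eventually_ge_atTop ⌈|v x|⌉₊] with n hn
    have h1 : |v x| ≤ n := (Nat.le_ceil _).trans (by exact_mod_cast hn)
    simp only [hw]
    rw [min_eq_left (abs_le.1 h1).2, max_eq_right (abs_le.1 h1).1]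
  calc ∫⁻ x in Q, ENNReal.ofReal (|v x| ^ R)
      = ∫⁻ x in Q, liminf (fun n => ENNReal.ofReal (|w n x| ^ R)) atTop := by simp_rw [hlim]
    _ ≤ liminf (fun n => ∫⁻ x in Q, ENNReal.ofReal (|w n x| ^ R)) atTop :=
        lintegral_liminf_le' fun n => by have := hwm n; fun_prop
    _ ≤ ENNReal.ofReal (localConst V R₀) :=
        (liminf_le_liminf (Eventually.of_forall hbound)).trans (by simp)

end Local

/-! ### The local Sobolev inequality with a variable exponent -/

section LocalVariable

variable {N : ℕ} {Q : Set (EuclideanSpace ℝ (Fin N))} {V s : ℝ}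
  {p : EuclideanSpace ℝ (Fin N) × EuclideanSpace ℝ (Fin N) → ℝ}
  {u : EuclideanSpace ℝ (Fin N) → ℝ}

lemma rpow_abs_sub_le_gagliardoKernel {e : ℝ} (he : 0 < e) {x y : EuclideanSpace ℝ (Fin N)}
    (hp : e ≤ p (x, y)) : ENNReal.ofReal (|u x - u y| ^ e) ≤
      ENNReal.ofReal (‖x - y‖ ^ (s * e)) *
        (1 + ENNReal.ofReal (‖x - y‖ ^ (N : ℝ)) * gagliardoKernel s p u x y) := by
  rw [gagliardoKernel, ← ENNReal.ofReal_mul (by positivity), ← ENNReal.ofReal_one,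
    ← ENNReal.ofReal_add (by positivity) (by positivity), ← ENNReal.ofReal_mul (by positivity)]
  refine ENNReal.ofReal_le_ofReal (rpow_le_rpow_mul_one_add (abs_nonneg _) (norm_nonneg _) he hp
    fun h => ?_)
  rw [sub_eq_zero.1 (norm_eq_zero.1 h), sub_self, abs_zero]

/-- The local Sobolev inequality for a variable exponent between `a` and `b`, for a function whose
local modulars are at most `l ^ b`. -/
lemma lintegral_rpow_le_of_modular_le (hN : 0 < N) (hQc : Convex ℝ Q) (hQm : MeasurableSet Q)
    (hQd : ∀ x ∈ Q, ∀ y ∈ Q, ‖x - y‖ ≤ 1) (hV : 0 < V) (hvol : volume Q = ENNReal.ofReal V)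
    (hu : AEMeasurable u (volume.restrict Q)) {a b R R₀ l : ℝ}
    (ha : 1 ≤ a) (hs : 0 < s) (hsa : s * a < N) (hR : R * (N - s * a) = N * a) (hRR : R ≤ R₀)
    (hpa : ∀ x ∈ Q, ∀ y ∈ Q, a ≤ p (x, y)) (hpb : ∀ x ∈ Q, ∀ y ∈ Q, p (x, y) ≤ b)
    (hl : 0 < l) (hl1 : l ≤ 1)
    (hum : ∫⁻ x in Q, ENNReal.ofReal (|u x| ^ p (x, x)) ≤ ENNReal.ofReal (l ^ b))
    (hug : ∫⁻ y in Q, ∫⁻ x in Q, gagliardoKernel s p u x y ≤ ENNReal.ofReal (l ^ b)) :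
    ∫⁻ x in Q, ENNReal.ofReal (|u x| ^ R) ≤ ENNReal.ofReal (localConst V R₀ * l ^ R) := by
  have hlb : 0 < l ^ b := by positivity
  have hlp : ∀ x ∈ Q, ∀ y ∈ Q, (l ^ p (x, y))⁻¹ ≤ (l ^ b)⁻¹ := fun x hx y hy => by
    have := Real.rpow_le_rpow_of_exponent_ge hl hl1 (hpb x hx y hy)
    gcongr
  have hcancel : ENNReal.ofReal (l ^ b)⁻¹ * ENNReal.ofReal (l ^ b) = 1 := by
    rw [← ENNReal.ofReal_mul (by positivity), inv_mul_cancel₀ hlb.ne', ENNReal.ofReal_one]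
  have key := lintegral_rpow_le_localConst (v := fun x => u x / l)
    (G := fun y x => ENNReal.ofReal (l ^ b)⁻¹ * gagliardoKernel s p u x y) hN hQc hQm hQd hV hvol
    (by fun_prop) ha hs hsa hR hRR ?_ ?_ ?_
  · have h1 : ∀ x, ENNReal.ofReal (|u x| ^ R) =
        ENNReal.ofReal (l ^ R) * ENNReal.ofReal (|u x / l| ^ R) := by
      intro x
      rw [← ENNReal.ofReal_mul (by positivity), ← Real.mul_rpow hl.le (abs_nonneg _), abs_div,
        abs_of_pos hl, mul_div_cancel₀ _ hl.ne']
    simp_rw [h1]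
    rw [lintegral_const_mul' _ _ ENNReal.ofReal_ne_top, mul_comm (localConst V R₀),
      ENNReal.ofReal_mul (by positivity)]
    gcongr
  · intro y hy x hx
    rw [abs_sub_comm, norm_sub_rev]
    refine (rpow_abs_sub_le_gagliardoKernel (s := s) (u := fun x => u x / l) (by linarith)
      (hpa x hx y hy)).trans ?_
    gcongr
    rw [gagliardoKernel_div hl, gagliardoKernel, ← ENNReal.ofReal_mul (by positivity)]
    apply ENNReal.ofReal_le_ofReal
    rw [mul_comm (l ^ _), ← div_div, div_eq_inv_mul]
    have := hlp x hx y hy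
    gcongr
  · simp_rw [lintegral_const_mul' _ _ ENNReal.ofReal_ne_top]
    rw [← hcancel]
    gcongr
  · have h1 : ∀ x ∈ Q, ENNReal.ofReal (|u x / l| ^ a) ≤
        1 + ENNReal.ofReal (l ^ b)⁻¹ * ENNReal.ofReal (|u x| ^ p (x, x)) := by
      intro x hx
      rw [← ENNReal.ofReal_mul (by positivity), ← ENNReal.ofReal_one,
        ← ENNReal.ofReal_add (by positivity) (by positivity)]
      apply ENNReal.ofReal_le_ofReal
      refine (rpow_le_one_add_rpow (abs_nonneg _) (by linarith) (hpa x hx x hx)).trans ?_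
      rw [abs_div, abs_of_pos hl, Real.div_rpow (abs_nonneg _) hl.le, div_eq_inv_mul]
      have := hlp x hx x hx
      gcongr
    refine (setLIntegral_mono' hQm h1).trans ?_
    rw [lintegral_add_left measurable_const, lintegral_const_mul' _ _ ENNReal.ofReal_ne_top,
      setLIntegral_const, one_mul, hvol, ENNReal.ofReal_add hV.le one_pos.le, ENNReal.ofReal_one,
      ← hcancel]
    gcongr

/-- The homogeneous form of the local Sobolev inequality: the right-hand side is additive over
disjoint sets. -/
lemma lintegral_rpow_le_mul_modular (hN : 0 < N) (hQc : Convex ℝ Q) (hQm : MeasurableSet Q)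
    (hQd : ∀ x ∈ Q, ∀ y ∈ Q, ‖x - y‖ ≤ 1) (hV : 0 < V) (hvol : volume Q = ENNReal.ofReal V)
    (hu : AEMeasurable u (volume.restrict Q)) {a b R R₀ : ℝ}
    (ha : 1 ≤ a) (hs : 0 < s) (hsa : s * a < N) (hR : R * (N - s * a) = N * a) (hRR : R ≤ R₀)
    (hpa : ∀ x ∈ Q, ∀ y ∈ Q, a ≤ p (x, y)) (hpb : ∀ x ∈ Q, ∀ y ∈ Q, p (x, y) ≤ b)
    (hb : 0 < b) (hbR : b ≤ R)
    (hum : ∫⁻ x in Q, ENNReal.ofReal (|u x| ^ p (x, x)) ≤ 1)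
    (hug : ∫⁻ y in Q, ∫⁻ x in Q, gagliardoKernel s p u x y ≤ 1) :
    ∫⁻ x in Q, ENNReal.ofReal (|u x| ^ R) ≤ ENNReal.ofReal (localConst V R₀) *
      ((∫⁻ x in Q, ENNReal.ofReal (|u x| ^ p (x, x))) +
        ∫⁻ y in Q, ∫⁻ x in Q, gagliardoKernel s p u x y) := by
  set A := ∫⁻ x in Q, ENNReal.ofReal (|u x| ^ p (x, x))
  set B := ∫⁻ y in Q, ∫⁻ x in Q, gagliardoKernel s p u x y
  have hC := one_le_localConst hV (R₀ := R₀) (by linarith)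
  have hstep : ∀ c : ℝ, 0 < c → c ≤ 1 → max A B ≤ ENNReal.ofReal c →
      ∫⁻ x in Q, ENNReal.ofReal (|u x| ^ R) ≤
        ENNReal.ofReal (localConst V R₀) * ENNReal.ofReal c := by
    intro c hc hc1 hAB
    have e : (c ^ (1 / b)) ^ b = c := by
      rw [← Real.rpow_mul hc.le, one_div_mul_cancel hb.ne', Real.rpow_one]
    have hl1 : c ^ (1 / b) ≤ 1 := Real.rpow_le_one hc.le hc1 (by positivity)
    refine (lintegral_rpow_le_of_modular_le (l := c ^ (1 / b)) hN hQc hQm hQd hV hvol hu ha hs hsa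
      hR hRR hpa hpb (by positivity) hl1 ?_ ?_).trans ?_
    · rw [e]; exact (le_max_left _ _).trans hAB
    · rw [e]; exact (le_max_right _ _).trans hAB
    · rw [← ENNReal.ofReal_mul (by linarith)]
      apply ENNReal.ofReal_le_ofReal
      gcongr
      conv_rhs => rw [← e]
      exact Real.rpow_le_rpow_of_exponent_ge (by positivity) hl1 hbR
  have hm1 : max A B ≤ 1 := max_le hum hug
  have hmtop : max A B ≠ ∞ := (hm1.trans_lt ENNReal.one_lt_top).ne
  have hfin : ∫⁻ x in Q, ENNReal.ofReal (|u x| ^ R) ≤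
      ENNReal.ofReal (localConst V R₀) * max A B := by
    -- the infimum over admissible `c`; it is not attained when both modulars vanish
    have hcont : Tendsto (fun c : ℝ => ENNReal.ofReal (localConst V R₀) *
        ENNReal.ofReal (max (max A B).toReal c)) (𝓝[>] 0)
        (𝓝 (ENNReal.ofReal (localConst V R₀) * max A B)) := by
      refine ENNReal.Tendsto.const_mul ?_ (Or.inr ENNReal.ofReal_ne_top)
      have h1 : Continuous fun c : ℝ => ENNReal.ofReal (max (max A B).toReal c) :=
        ENNReal.continuous_ofReal.comp (by fun_prop)
      have h2 := h1.tendsto 0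
      rw [max_eq_left ENNReal.toReal_nonneg, ENNReal.ofReal_toReal hmtop] at h2
      exact h2.mono_left nhdsWithin_le_nhds
    refine ge_of_tendsto hcont ?_
    filter_upwards [Ioc_mem_nhdsGT one_pos] with c hc
    refine hstep _ (lt_max_of_lt_right hc.1) (max_le ?_ hc.2) ?_
    · simpa using ENNReal.toReal_mono ENNReal.one_ne_top hm1
    · rw [← ENNReal.ofReal_toReal hmtop]
      refine ENNReal.ofReal_le_ofReal ?_
      rw [ENNReal.ofReal_toReal hmtop]
      exact le_max_left _ _
  exact hfin.trans (mul_le_mul_right (max_le le_self_add le_add_self) _)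

end LocalVariable

/-! ### Grids of cubes -/

section Cubes

variable {N : ℕ} {h : ℝ} {k : Fin N → ℤ}

/-- The half-open cube `h (k + [0,1)ᴺ)` of the grid of side length `h`. -/
def gridCube (h : ℝ) (k : Fin N → ℤ) : Set (EuclideanSpace ℝ (Fin N)) :=
  {x | ∀ i, ⌊x i / h⌋ = k i}

lemma mem_gridCube_iff (hh : 0 < h) {x : EuclideanSpace ℝ (Fin N)} :
    x ∈ gridCube h k ↔ ∀ i, x i ∈ Set.Ico (k i * h) ((k i + 1) * h) := by
  simp only [gridCube, Set.mem_ofPred_eq, Int.floor_eq_iff, le_div_iff₀ hh, div_lt_iff₀ hh,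
    Set.mem_Ico]

lemma measurableSet_gridCube : MeasurableSet (gridCube h k) := by
  have : gridCube h k = ⋂ i, {x | ⌊x i / h⌋ = k i} := by ext; simp [gridCube]
  rw [this]
  refine MeasurableSet.iInter fun i => ?_
  have h1 : Measurable fun x : EuclideanSpace ℝ (Fin N) => ⌊x i / h⌋ :=
    Int.measurable_floor.comp (by fun_prop)
  exact h1 (measurableSet_singleton (k i))

lemma convex_gridCube (hh : 0 < h) : Convex ℝ (gridCube h k) := by
  have : gridCube h k = ⋂ i, (EuclideanSpace.proj (𝕜 := ℝ) i) ⁻¹'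
      Set.Ico (k i * h) ((k i + 1) * h) := by
    ext x; simp [mem_gridCube_iff hh]
  rw [this]
  exact convex_iInter fun i => (convex_Ico _ _).linear_preimage
    (EuclideanSpace.proj (𝕜 := ℝ) i).toLinearMap

lemma volume_gridCube (hh : 0 < h) :
    volume (gridCube h k) = ENNReal.ofReal (h ^ N) := by
  have : gridCube h k = (WithLp.ofLp) ⁻¹'
      Set.pi Set.univ fun i => Set.Ico (k i * h) ((k i + 1) * h) := by
    ext x; simp [mem_gridCube_iff hh]
  rw [this, (PiLp.volume_preserving_ofLp (Fin N)).measure_preimage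
    (MeasurableSet.univ_pi fun _ => measurableSet_Ico).nullMeasurableSet, Real.volume_pi_Ico]
  simp [add_mul, ENNReal.ofReal_pow hh.le]

lemma norm_le_mul_of_forall_abs_le {z : EuclideanSpace ℝ (Fin N)} {m : ℝ}
    (hz : ∀ i, |z i| ≤ m) : ‖z‖ ≤ N * m := by
  rcases Nat.eq_zero_or_pos N with rfl | hN
  · simp [EuclideanSpace.norm_eq]
  have hN1 : (1 : ℝ) ≤ N := by exact_mod_cast hN
  have hm : 0 ≤ m := (abs_nonneg _).trans (hz ⟨0, hN⟩)
  rw [EuclideanSpace.norm_eq]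
  refine Real.sqrt_le_iff.2 ⟨by positivity, ?_⟩
  calc ∑ i, ‖z i‖ ^ 2 ≤ ∑ _i : Fin N, m ^ 2 := Finset.sum_le_sum fun i _ => by
        have := hz i
        rw [Real.norm_eq_abs]
        gcongr
    _ = N * m ^ 2 := by simp
    _ ≤ (N * m) ^ 2 := by nlinarith [sq_nonneg m]

lemma norm_sub_le_of_mem_gridCube (hh : 0 < h) {x y : EuclideanSpace ℝ (Fin N)}
    (hx : x ∈ gridCube h k) (hy : y ∈ gridCube h k) : ‖x - y‖ ≤ N * h := by
  refine norm_le_mul_of_forall_abs_le fun i => ?_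
  have h1 := (mem_gridCube_iff hh).1 hx i
  have h2 := (mem_gridCube_iff hh).1 hy i
  rw [Set.mem_Ico] at h1 h2
  rw [PiLp.sub_apply, abs_le]
  constructor <;> linarith

lemma iUnion_gridCube : ⋃ k : Fin N → ℤ, gridCube h k = Set.univ := by
  ext x
  simp only [Set.mem_iUnion, Set.mem_univ, iff_true]
  exact ⟨fun i => ⌊x i / h⌋, fun i => rfl⟩

lemma pairwise_disjoint_gridCube :
    Pairwise (Function.onFun Disjoint fun k : Fin N → ℤ => gridCube h k) := by
  intro k l hkl
  refine Set.disjoint_left.2 fun x hx hy => hkl (funext fun i => ?_)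
  rw [← hx i, ← hy i]

lemma tsum_lintegral_gridCube (f : EuclideanSpace ℝ (Fin N) → ℝ≥0∞) :
    ∑' k : Fin N → ℤ, ∫⁻ x in gridCube h k, f x = ∫⁻ x, f x := by
  rw [← lintegral_iUnion (fun _ => measurableSet_gridCube) pairwise_disjoint_gridCube,
    iUnion_gridCube, Measure.restrict_univ]

lemma sum_lintegral_gridCube_le (S : Finset (Fin N → ℤ))
    (f : EuclideanSpace ℝ (Fin N) → ℝ≥0∞) :
    ∑ k ∈ S, ∫⁻ x in gridCube h k, f x ≤ ∫⁻ x, f x :=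
  (ENNReal.sum_le_tsum S).trans (tsum_lintegral_gridCube f).le

end Cubes

/-! ### The global embedding -/

section Global

lemma CPlus.iInf_le {X : Type*} [TopologicalSpace X] {h : X → ℝ} (hh : CPlus h) (x : X) :
    ⨅ x, h x ≤ h x := by
  refine ciInf_le ?_ x
  by_contra hb
  have h1 := hh.2.1
  rw [Real.iInf_of_not_bddBelow hb] at h1
  linarith

lemma CPlus.one_lt {X : Type*} [TopologicalSpace X] {h : X → ℝ} (hh : CPlus h) (x : X) :
    1 < h x := hh.2.1.trans_le (hh.iInf_le x)

lemma CPlus.le_iSup {X : Type*} [TopologicalSpace X] {h : X → ℝ} (hh : CPlus h) (x : X) :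
    h x ≤ ⨆ x, h x := le_ciSup hh.2.2 x

/-- A subcritical exponent `r₀` with gap `η` stays below the critical exponent of `P - ε`. -/
lemma add_le_critical {n s P Pm r₀ rm η ε : ℝ} (hs : 0 < s) (hP : 0 < P)
    (hPm : P ≤ Pm) (hsP : s * Pm < n) (hr : r₀ ≤ n * P / (n - s * P) - η) (hrm : r₀ ≤ rm)
    (hη : 0 < η) (hε : 0 < ε) (hε1 : ε ≤ 1) (hεη : ε * (s * rm + 2 * n + s) ≤ η * (n - s * Pm)) :
    r₀ + ε ≤ n * (P - ε) / (n - s * (P - ε)) := by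
  have hsPP : s * P ≤ s * Pm := by gcongr
  have hk : 0 < n - s * P := by linarith
  have hse : 0 < s * ε := by positivity
  have h1 : r₀ * (n - s * P) ≤ n * P - η * (n - s * P) := by
    have h2 := mul_le_mul_of_nonneg_right hr hk.le
    rwa [sub_mul, div_mul_cancel₀ _ hk.ne'] at h2
  have h3 : η * (n - s * Pm) ≤ η * (n - s * P) := by gcongr
  have h4 : r₀ * (s * ε) ≤ rm * (s * ε) := by gcongr
  have h5 : s * ε * ε ≤ s * ε * 1 := by gcongr
  have h6 : 0 ≤ ε * (s * P) := by positivity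
  rw [le_div_iff₀ (by linarith)]
  nlinarith

variable {N : ℕ} {s : ℝ} {p : EuclideanSpace ℝ (Fin N) × EuclideanSpace ℝ (Fin N) → ℝ}

lemma pos_dim (hs : 0 < s) (hp : CPlus p) (hsp : s * (⨆ z, p z) < N) : 0 < N := by
  have h1 := (hp.one_lt 0).trans_le (hp.le_iSup 0)
  have h2 : 0 < s * ⨆ z, p z := by positivity
  exact_mod_cast h2.trans hsp

lemma setLIntegral_gagliardoKernel_le (Q : Set (EuclideanSpace ℝ (Fin N)))
    (u : EuclideanSpace ℝ (Fin N) → ℝ) :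
    ∫⁻ y in Q, ∫⁻ x in Q, gagliardoKernel s p u x y ≤ gagliardoModular s p u 1 := by
  rw [gagliardoModular_one]
  exact (lintegral_mono fun y => setLIntegral_le_lintegral _ _).trans (setLIntegral_le_lintegral _ _)

/-- The Sobolev inequality for modulars: on each cube of a fine grid the exponent oscillates so
little that the local inequality with a constant exponent applies, and its homogeneous right-hand
sides add up. -/
lemma exists_modular_le (hs0 : 0 < s) (hp : CPlus p) (hpu : UniformContinuous p)
    (hsp : s * (⨆ z, p z) < N) {r : EuclideanSpace ℝ (Fin N) → ℝ} (hr : CPlus r)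
    (hru : UniformContinuous r) (hpr : ∀ x, p (x, x) ≤ r x)
    (hgap : 0 < ⨅ x, (criticalExponent s p x - r x)) :
    ∃ C : ℝ, 1 ≤ C ∧ ∀ u : EuclideanSpace ℝ (Fin N) → ℝ, AEMeasurable u volume →
      modular volume (fun x => p (x, x)) u ≤ 1 → gagliardoModular s p u 1 ≤ 1 →
      modular volume r u ≤ ENNReal.ofReal C := by
  have hN : 0 < N := pos_dim hs0 hp hsp
  have hn : (0 : ℝ) < N := by exact_mod_cast hN
  set η := ⨅ x, (criticalExponent s p x - r x) with hη
  have hrη : ∀ x, r x ≤ criticalExponent s p x - η := by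
    intro x
    have hb : BddBelow (Set.range fun x => criticalExponent s p x - r x) := by
      by_contra hb
      rw [hη, Real.iInf_of_not_bddBelow hb] at hgap
      exact lt_irrefl _ hgap
    have := ciInf_le hb x
    linarith
  set Pm := ⨆ z, p z with hPm
  set pm := ⨅ z, p z with hpm
  set rm := ⨆ x, r x with hrm
  have hpm1 : 1 < pm := hp.2.1
  have hrm0 : 0 < rm := by linarith [hr.one_lt 0, hr.le_iSup 0]
  have hκ : 0 < N - s * Pm := by linarith
  obtain ⟨ε, hε, hε1, hεp, hεη⟩ : ∃ ε : ℝ, 0 < ε ∧ ε ≤ 1 ∧ ε ≤ pm - 1 ∧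
      ε * (s * rm + 2 * N + s) ≤ η * (N - s * Pm) := by
    have hD : 0 < s * rm + 2 * N + s := by positivity
    refine ⟨min (min 1 (pm - 1)) (η * (N - s * Pm) / (s * rm + 2 * N + s)), ?_, ?_, ?_, ?_⟩
    · refine lt_min (lt_min one_pos (by linarith)) (by positivity)
    · exact (min_le_left _ _).trans (min_le_left _ _)
    · exact (min_le_left _ _).trans (min_le_right _ _)
    · rw [← le_div_iff₀ hD]; exact min_le_right _ _
  obtain ⟨δp, hδp, hpδ⟩ := Metric.uniformContinuous_iff.1 hpu ε hε
  obtain ⟨δr, hδr, hrδ⟩ := Metric.uniformContinuous_iff.1 hru ε hε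
  set δ := min 1 (min δp δr) with hδ
  have hδ0 : 0 < δ := lt_min one_pos (lt_min hδp hδr)
  set h := δ / (N + 1) with hh
  have hh0 : 0 < h := by positivity
  have hNh : N * h < δ := by
    rw [hh, mul_div_assoc', div_lt_iff₀ (by positivity)]
    nlinarith
  set R₀ := N * Pm / (N - s * Pm) with hR₀
  have hV : 0 < h ^ N := by positivity
  have hR₀0 : 0 ≤ R₀ := by
    have : 0 < Pm := by linarith [hp.one_lt 0, hp.le_iSup 0]
    positivity
  set C := localConst (h ^ N) R₀ with hC
  have hC1 : 1 ≤ C := one_le_localConst hV hR₀0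
  refine ⟨1 + 2 * C, by linarith, fun u hu hum hug => ?_⟩
  have hcube : ∀ k : Fin N → ℤ, ∫⁻ x in gridCube h k, ENNReal.ofReal (|u x| ^ r x) ≤
      (∫⁻ x in gridCube h k, ENNReal.ofReal (|u x| ^ p (x, x))) + ENNReal.ofReal C *
      ((∫⁻ x in gridCube h k, ENNReal.ofReal (|u x| ^ p (x, x))) +
        ∫⁻ y in gridCube h k, ∫⁻ x, gagliardoKernel s p u x y) := by
    intro k
    rcases (gridCube h k).eq_empty_or_nonempty with he | ⟨x₀, hx₀⟩
    · simp [he]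
    have hd : ∀ x ∈ gridCube h k, ∀ y ∈ gridCube h k, ‖x - y‖ < δ := fun x hx y hy =>
      (norm_sub_le_of_mem_gridCube hh0 hx hy).trans_lt hNh
    have hosc : ∀ x ∈ gridCube h k, ∀ y ∈ gridCube h k, |p (x, y) - p (x₀, x₀)| < ε := by
      intro x hx y hy
      rw [← Real.dist_eq]
      apply hpδ
      rw [Prod.dist_eq, dist_eq_norm, dist_eq_norm]
      have h1 : δ ≤ δp := (min_le_right _ _).trans (min_le_left _ _)
      exact max_lt ((hd x hx x₀ hx₀).trans_le h1) ((hd y hy x₀ hx₀).trans_le h1)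
    have hoscr : ∀ x ∈ gridCube h k, |r x - r x₀| < ε := by
      intro x hx
      rw [← Real.dist_eq]
      apply hrδ
      rw [dist_eq_norm]
      exact (hd x hx x₀ hx₀).trans_le ((min_le_right _ _).trans (min_le_right _ _))
    set P := p (x₀, x₀) with hP
    have hPpm : pm ≤ P := hp.iInf_le _
    have hPPm : P ≤ Pm := hp.le_iSup _
    have hsaP : s * (P - ε) ≤ s * Pm := by
      gcongr; linarith
    have hsa : 0 < N - s * (P - ε) := by linarith
    set R := N * (P - ε) / (N - s * (P - ε)) with hR
    have hrR : r x₀ + ε ≤ R := add_le_critical hs0 (by linarith) hPPm hsp (hrη x₀)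
      (hr.le_iSup x₀) hgap hε hε1 hεη
    have hRR : R ≤ R₀ := by
      have : P - ε ≤ Pm := by linarith
      have : 0 ≤ P - ε := by linarith
      have : 0 ≤ N * Pm := by
        have : 0 ≤ Pm := by linarith
        positivity
      rw [hR, hR₀]
      gcongr
    have hloc := lintegral_rpow_le_mul_modular (s := s) (p := p) (u := u) (a := P - ε) (b := P + ε)
      hN (convex_gridCube (k := k) hh0) measurableSet_gridCube
      (fun x hx y hy => ((hd x hx y hy).trans_le (min_le_left _ _)).le) hV (volume_gridCube hh0)
      hu.restrict (by linarith) hs0 (by linarith) (div_mul_cancel₀ _ hsa.ne') hRR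
      (fun x hx y hy => by linarith [(abs_lt.1 (hosc x hx y hy)).1])
      (fun x hx y hy => by linarith [(abs_lt.1 (hosc x hx y hy)).2])
      (by linarith) (by linarith [hpr x₀]) ((setLIntegral_le_lintegral _ _).trans hum)
      ((setLIntegral_gagliardoKernel_le _ _).trans hug)
    have hptw : ∀ x ∈ gridCube h k, ENNReal.ofReal (|u x| ^ r x) ≤
        ENNReal.ofReal (|u x| ^ p (x, x)) + ENNReal.ofReal (|u x| ^ R) := by
      intro x hx
      rw [← ENNReal.ofReal_add (by positivity) (by positivity)]
      refine ENNReal.ofReal_le_ofReal (rpow_le_add_rpow (abs_nonneg _) (hpr x) ?_ ?_)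
      · linarith [(abs_lt.1 (hoscr x hx)).2]
      · linarith [hp.one_lt (x, x)]
    refine (setLIntegral_mono' measurableSet_gridCube hptw).trans ?_
    rw [lintegral_add_right' _ (by have := hu.restrict (s := gridCube h k); fun_prop)]
    gcongr
    refine hloc.trans ?_
    gcongr
    exact Measure.restrict_le_self
  rw [modular, ← tsum_lintegral_gridCube (h := h)]
  refine (ENNReal.tsum_le_tsum hcube).trans ?_
  rw [ENNReal.tsum_add, ENNReal.tsum_mul_left, ENNReal.tsum_add, tsum_lintegral_gridCube,
    tsum_lintegral_gridCube, ← gagliardoModular_one]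
  rw [modular] at hum
  calc _ ≤ 1 + ENNReal.ofReal C * (1 + 1) := by gcongr
    _ = _ := by
      rw [ENNReal.ofReal_add one_pos.le (by linarith), ENNReal.ofReal_mul (by norm_num),
        ENNReal.ofReal_one, mul_comm, one_add_one_eq_two]
      norm_num

/-- A bound for modulars on the unit ball of the Sobolev space is a bound for norms. -/
lemma luxemburgNorm_le_mul_sobolevNorm (hp : CPlus p) {μ : Measure (EuclideanSpace ℝ (Fin N))}
    (hμ : μ ≪ volume) {r : EuclideanSpace ℝ (Fin N) → ℝ} (hr : CPlus r) {C : ℝ} (hC : 1 ≤ C)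
    (h : ∀ u : EuclideanSpace ℝ (Fin N) → ℝ, AEMeasurable u volume →
      modular volume (fun x => p (x, x)) u ≤ 1 → gagliardoModular s p u 1 ≤ 1 →
      modular μ r u ≤ ENNReal.ofReal C) {u : EuclideanSpace ℝ (Fin N) → ℝ}
    (hu : u ∈ sobolevSpace s p) :
    u ∈ lebesgueSpace μ r ∧ luxemburgNorm μ r u ≤ C.toNNReal * sobolevNorm s p u := by
  have hfin := sobolevNorm_lt_top (fun z => (hp.one_lt z).le) hu
  set n := (sobolevNorm s p u).toReal with hn
  have hn0 : 0 ≤ n := ENNReal.toReal_nonneg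
  have hnn : sobolevNorm s p u = ENNReal.ofReal n := (ENNReal.ofReal_toReal hfin.ne).symm
  have hC0 : 0 < C := by linarith
  have hmod : ∀ t, n < t → modular μ r (fun x => u x / t) ≤ ENNReal.ofReal C := by
    intro t ht
    have ht0 : 0 < t := hn0.trans_lt ht
    obtain ⟨h1, h2⟩ := modular_div_le_one_of_sobolevNorm_lt (s := s) (u := u)
      (fun z => (zero_lt_one.trans (hp.one_lt z)).le) ht0
      (by rw [hnn]; exact (ENNReal.ofReal_lt_ofReal_iff ht0).2 ht)
    exact h _ (hu.1.1.div_const t) h1 h2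
  refine ⟨⟨hu.1.1.mono_ac hμ, ?_⟩, ?_⟩
  · have h1 := modular_mul_le (μ := μ) (q := r) (u := fun x => u x / (n + 1)) (c := n + 1)
      (by linarith) hr.le_iSup
    have h2 : (fun x => (n + 1) * (u x / (n + 1))) = u := by
      funext x; field_simp
    rw [h2] at h1
    exact (h1.trans (mul_le_mul_right (hmod _ (by linarith)) _)).trans_lt
      (ENNReal.mul_lt_top ENNReal.ofReal_lt_top ENNReal.ofReal_lt_top)
  · have hle : ∀ t, n < t → luxemburgNorm μ r u ≤ ENNReal.ofReal (C * t) := fun t ht =>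
      luxemburgNorm_le_of_modular_le hC (hn0.trans_lt ht) (fun x => (hr.one_lt x).le) (hmod t ht)
    have hlim : Tendsto (fun t => ENNReal.ofReal (C * t)) (𝓝[>] n) (𝓝 (ENNReal.ofReal (C * n))) :=
      ((ENNReal.continuous_ofReal.comp (by fun_prop)).tendsto n).mono_left nhdsWithin_le_nhds
    have h1 : luxemburgNorm μ r u ≤ ENNReal.ofReal (C * n) :=
      ge_of_tendsto hlim (by filter_upwards [self_mem_nhdsWithin] with t ht using hle t ht)
    rwa [ENNReal.ofReal_mul hC0.le, ← hnn] at h1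

end Global

/-! ### Subcritical bounds and interpolation on compact sets -/

section LocalBounds

variable {N : ℕ} {s : ℝ} {p : EuclideanSpace ℝ (Fin N) × EuclideanSpace ℝ (Fin N) → ℝ}
  {r : EuclideanSpace ℝ (Fin N) → ℝ}

/-- Near every point the unit ball of the Sobolev space is bounded in a Lebesgue space with a
constant exponent `R` that exceeds the subcritical exponent `r` by a fixed margin. -/
lemma exists_ball_lintegral_rpow_le (hs0 : 0 < s) (hp : CPlus p)
    (hsp : s * (⨆ z, p z) < N) (hr : CPlus r) (hrc : ∀ x, r x < criticalExponent s p x)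
    (x₀ : EuclideanSpace ℝ (Fin N)) :
    ∃ δ > 0, ∃ ε > 0, ∃ R : ℝ, ∃ C : ℝ, (∀ x ∈ Metric.ball x₀ δ, r x + ε ≤ R) ∧ 1 ≤ C ∧
      ∀ u : EuclideanSpace ℝ (Fin N) → ℝ, AEMeasurable u volume →
        modular volume (fun x => p (x, x)) u ≤ 1 → gagliardoModular s p u 1 ≤ 1 →
        ∫⁻ x in Metric.ball x₀ δ, ENNReal.ofReal (|u x| ^ R) ≤ ENNReal.ofReal C := by
  have hN : 0 < N := pos_dim hs0 hp hsp
  have hn : (0 : ℝ) < N := by exact_mod_cast hN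
  set Pm := ⨆ z, p z with hPm
  set P := p (x₀, x₀) with hP
  have hP1 : 1 < P := hp.one_lt _
  have hPPm : P ≤ Pm := hp.le_iSup _
  have hr1 := hr.one_lt x₀
  set η := criticalExponent s p x₀ - r x₀ with hη
  have hη0 : 0 < η := by linarith [hrc x₀]
  have hκ : 0 < N - s * Pm := by linarith
  obtain ⟨ε, hε, hε1, hεp, hεη⟩ : ∃ ε : ℝ, 0 < ε ∧ ε ≤ 1 ∧ ε ≤ P - 1 ∧
      ε * (s * r x₀ + 2 * N + s) ≤ η * (N - s * Pm) := by
    have hD : 0 < s * r x₀ + 2 * N + s := by positivity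
    refine ⟨min (min 1 (P - 1)) (η * (N - s * Pm) / (s * r x₀ + 2 * N + s)), ?_, ?_, ?_, ?_⟩
    · refine lt_min (lt_min one_pos (by linarith)) (by positivity)
    · exact (min_le_left _ _).trans (min_le_left _ _)
    · exact (min_le_left _ _).trans (min_le_right _ _)
    · rw [← le_div_iff₀ hD]; exact min_le_right _ _
  have hRr : r x₀ + ε ≤ N * (P - ε) / (N - s * (P - ε)) :=
    add_le_critical hs0 (by linarith) hPPm hsp
      (by rw [hη, criticalExponent, ← hP]; linarith) le_rfl hη0 hε hε1 hεη
  set R := N * (P - ε) / (N - s * (P - ε)) with hR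
  obtain ⟨δp, hδp, hpδ⟩ := Metric.continuous_iff.1 hp.1 (x₀, x₀) ε hε
  obtain ⟨δr, hδr, hrδ⟩ := Metric.continuous_iff.1 hr.1 x₀ (ε / 2) (by positivity)
  set δ := min (1 / 2) (min δp δr) with hδ
  have hδ0 : 0 < δ := lt_min (by norm_num) (lt_min hδp hδr)
  have hδp' : δ ≤ δp := (min_le_right _ _).trans (min_le_left _ _)
  have hδr' : δ ≤ δr := (min_le_right _ _).trans (min_le_right _ _)
  have hδ1 : δ ≤ 1 / 2 := min_le_left _ _
  have hsaP : s * (P - ε) ≤ s * Pm := by gcongr; linarith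
  have hsa : 0 < N - s * (P - ε) := by linarith
  have hvolpos : 0 < (volume (Metric.ball x₀ δ)).toReal :=
    ENNReal.toReal_pos (Metric.measure_ball_pos _ _ hδ0).ne' measure_ball_lt_top.ne
  have hosc : ∀ x ∈ Metric.ball x₀ δ, ∀ y ∈ Metric.ball x₀ δ, |p (x, y) - P| < ε := by
    intro x hx y hy
    rw [← Real.dist_eq]
    apply hpδ
    rw [Prod.dist_eq]
    exact max_lt ((Metric.mem_ball.1 hx).trans_le hδp') ((Metric.mem_ball.1 hy).trans_le hδp')
  refine ⟨δ, hδ0, ε / 2, by positivity, R, localConst (volume (Metric.ball x₀ δ)).toReal R, ?_,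
    one_le_localConst hvolpos (by linarith), fun u hu hum hug => ?_⟩
  · intro x hx
    have h1 := hrδ x ((Metric.mem_ball.1 hx).trans_le hδr')
    rw [Real.dist_eq] at h1
    linarith [(abs_lt.1 h1).2]
  · have hloc := lintegral_rpow_le_of_modular_le (s := s) (p := p) (u := u) (a := P - ε)
      (b := P + ε) (l := 1) (R₀ := R) hN (convex_ball x₀ δ) measurableSet_ball
      (fun x hx y hy => by
        rw [← dist_eq_norm]
        have h1 := dist_triangle_right x y x₀
        have h2 := Metric.mem_ball.1 hx
        have h3 := Metric.mem_ball.1 hy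
        linarith) hvolpos (ENNReal.ofReal_toReal measure_ball_lt_top.ne).symm
      hu.restrict (by linarith) hs0 (by linarith) (div_mul_cancel₀ _ hsa.ne') le_rfl
      (fun x hx y hy => by linarith [(abs_lt.1 (hosc x hx y hy)).1])
      (fun x hx y hy => by linarith [(abs_lt.1 (hosc x hx y hy)).2])
      one_pos le_rfl
      (by rw [Real.one_rpow, ENNReal.ofReal_one]
          exact (setLIntegral_le_lintegral _ _).trans hum)
      (by rw [Real.one_rpow, ENNReal.ofReal_one]
          exact (setLIntegral_gagliardoKernel_le _ _).trans hug)
    rwa [Real.one_rpow, mul_one] at hloc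

lemma modular_restrict_union_le (A B : Set (EuclideanSpace ℝ (Fin N)))
    (u : EuclideanSpace ℝ (Fin N) → ℝ) : modular (volume.restrict (A ∪ B)) r u ≤
      modular (volume.restrict A) r u + modular (volume.restrict B) r u :=
  lintegral_union_le _ _ _

lemma modular_restrict_mono {A B : Set (EuclideanSpace ℝ (Fin N))} (hAB : A ⊆ B)
    (u : EuclideanSpace ℝ (Fin N) → ℝ) :
    modular (volume.restrict A) r u ≤ modular (volume.restrict B) r u :=
  lintegral_mono_set hAB

/-- The unit ball of the Sobolev space is bounded for the modular of a subcritical exponent on every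
compact set, which is covered by finitely many small balls. -/
lemma exists_modular_restrict_le (hs0 : 0 < s) (hp : CPlus p)
    (hsp : s * (⨆ z, p z) < N) (hr : CPlus r) (hrc : ∀ x, r x < criticalExponent s p x)
    {K : Set (EuclideanSpace ℝ (Fin N))} (hK : IsCompact K) :
    ∃ C : ℝ, 1 ≤ C ∧ ∀ u : EuclideanSpace ℝ (Fin N) → ℝ, AEMeasurable u volume →
      modular volume (fun x => p (x, x)) u ≤ 1 → gagliardoModular s p u 1 ≤ 1 →
      modular (volume.restrict K) r u ≤ ENNReal.ofReal C := by
  refine hK.induction_on (p := fun S => ∃ C : ℝ, 1 ≤ C ∧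
    ∀ u : EuclideanSpace ℝ (Fin N) → ℝ, AEMeasurable u volume →
      modular volume (fun x => p (x, x)) u ≤ 1 → gagliardoModular s p u 1 ≤ 1 →
      modular (volume.restrict S) r u ≤ ENNReal.ofReal C) ⟨1, le_rfl, by simp [modular]⟩ ?_ ?_ ?_
  · rintro A B hAB ⟨C, hC, h⟩
    exact ⟨C, hC, fun u h1 h2 h3 => (modular_restrict_mono hAB u).trans (h u h1 h2 h3)⟩
  · rintro A B ⟨C, hC, h⟩ ⟨C', hC', h'⟩
    refine ⟨C + C', by linarith, fun u h1 h2 h3 => (modular_restrict_union_le A B u).trans ?_⟩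
    rw [ENNReal.ofReal_add (by linarith) (by linarith)]
    exact add_le_add (h u h1 h2 h3) (h' u h1 h2 h3)
  · intro x₀ _
    obtain ⟨δ, hδ, ε, hε, R, C, hrR, hC, h⟩ :=
      exists_ball_lintegral_rpow_le hs0 hp hsp hr hrc x₀
    refine ⟨Metric.ball x₀ δ, mem_nhdsWithin_of_mem_nhds (Metric.ball_mem_nhds _ hδ),
      (volume (Metric.ball x₀ δ)).toReal + C,
      by linarith [ENNReal.toReal_nonneg (a := volume (Metric.ball x₀ δ))],
      fun u h1 h2 h3 => ?_⟩
    have hpt : ∀ x ∈ Metric.ball x₀ δ, ENNReal.ofReal (|u x| ^ r x) ≤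
        1 + ENNReal.ofReal (|u x| ^ R) := fun x hx => by
      rw [← ENNReal.ofReal_one, ← ENNReal.ofReal_add (by positivity) (by positivity)]
      exact ENNReal.ofReal_le_ofReal (rpow_le_one_add_rpow (abs_nonneg _)
        (by linarith [hr.one_lt x]) (by linarith [hrR x hx]))
    refine (setLIntegral_mono' measurableSet_ball hpt).trans ?_
    rw [lintegral_add_left measurable_const, setLIntegral_const, one_mul,
      ENNReal.ofReal_add ENNReal.toReal_nonneg (by linarith),
      ENNReal.ofReal_toReal measure_ball_lt_top.ne]
    gcongr
    exact h u h1 h2 h3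

lemma rpow_le_mul_add_mul_rpow {x M ρ ε R : ℝ} (hx : 0 ≤ x) (hM : 1 ≤ M) (hρ : 1 ≤ ρ)
    (hε : 0 < ε) (hR : ρ + ε ≤ R) : x ^ ρ ≤ M ^ R * x + M ^ (-ε) * x ^ R := by
  have hM0 : 0 < M := by linarith
  rcases hx.eq_or_lt with rfl | hx
  · rw [Real.zero_rpow (by linarith), Real.zero_rpow (by linarith)]; simp
  rcases le_total x M with h | h
  · have h1 : x ^ ρ = x ^ (ρ - 1) * x := by
      rw [Real.rpow_sub hx, Real.rpow_one]; field_simp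
    have h2 : x ^ (ρ - 1) ≤ M ^ R :=
      (Real.rpow_le_rpow hx.le h (by linarith)).trans
        (Real.rpow_le_rpow_of_exponent_le hM (by linarith))
    have h3 : x ^ (ρ - 1) * x ≤ M ^ R * x := by gcongr
    have : 0 ≤ M ^ (-ε) * x ^ R := by positivity
    linarith
  · have h1 : x ^ ρ = x ^ (ρ - R) * x ^ R := by rw [← Real.rpow_add hx, sub_add_cancel]
    have h2 : x ^ (ρ - R) ≤ M ^ (-ε) :=
      (Real.rpow_le_rpow_of_nonpos hM0 h (by linarith)).trans
        (Real.rpow_le_rpow_of_exponent_le hM (by linarith))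
    have h3 : x ^ (ρ - R) * x ^ R ≤ M ^ (-ε) * x ^ R := by gcongr
    have : 0 ≤ M ^ R * x := by positivity
    linarith

/-- Interpolation: a sequence in the unit ball of the Sobolev space that is Cauchy in `L¹_loc` is
Cauchy for the modular of every subcritical exponent, on every compact set. -/
lemma tendsto_modular_sub (hs0 : 0 < s) (hp : CPlus p)
    (hsp : s * (⨆ z, p z) < N) (hr : CPlus r) (hrc : ∀ x, r x < criticalExponent s p x)
    {w : ℕ → EuclideanSpace ℝ (Fin N) → ℝ} (hw : ∀ n, AEMeasurable (w n) volume)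
    (hwm : ∀ n, modular volume (fun x => p (x, x)) (w n) ≤ 1)
    (hwg : ∀ n, gagliardoModular s p (w n) 1 ≤ 1)
    (hL : ∀ J : ℕ, Tendsto (fun ij : ℕ × ℕ => ∫⁻ x in Metric.ball 0 J, ‖w ij.1 x - w ij.2 x‖ₑ)
      atTop (𝓝 0))
    {K : Set (EuclideanSpace ℝ (Fin N))} (hK : IsCompact K) :
    Tendsto (fun ij : ℕ × ℕ => modular (volume.restrict K) r (w ij.1 - w ij.2)) atTop (𝓝 0) := by
  refine hK.induction_on (p := fun S => Tendsto (fun ij : ℕ × ℕ =>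
    modular (volume.restrict S) r (w ij.1 - w ij.2)) atTop (𝓝 0)) ?_ ?_ ?_ ?_
  · simp [modular]
  · intro A B hAB hB
    exact tendsto_of_tendsto_of_tendsto_of_le_of_le tendsto_const_nhds hB (fun _ => zero_le)
      fun ij => modular_restrict_mono hAB _
  · intro A B hA hB
    have h := hA.add hB
    rw [add_zero] at h
    exact tendsto_of_tendsto_of_tendsto_of_le_of_le tendsto_const_nhds h (fun _ => zero_le)
      fun ij => modular_restrict_union_le A B _
  · intro x₀ _
    obtain ⟨δ, hδ, ε, hε, R, C, hrR, hC, h⟩ :=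
      exists_ball_lintegral_rpow_le hs0 hp hsp hr hrc x₀
    refine ⟨Metric.ball x₀ δ, mem_nhdsWithin_of_mem_nhds (Metric.ball_mem_nhds _ hδ), ?_⟩
    have hR0 : 0 < R := by linarith [hrR x₀ (Metric.mem_ball_self hδ), hr.one_lt x₀]
    obtain ⟨J, hJ⟩ := exists_nat_gt (‖x₀‖ + δ)
    have hBJ : Metric.ball x₀ δ ⊆ Metric.ball 0 (J : ℝ) := by
      apply Metric.ball_subset_ball'
      rw [dist_zero_right]; linarith
    set C' := 2 ^ R * (C + C) with hC'
    have hdiff : ∀ i j, ∫⁻ x in Metric.ball x₀ δ, ENNReal.ofReal (|(w i - w j) x| ^ R) ≤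
        ENNReal.ofReal C' := by
      intro i j
      have hpt : ∀ x, ENNReal.ofReal (|(w i - w j) x| ^ R) ≤ ENNReal.ofReal (2 ^ R) *
          (ENNReal.ofReal (|w i x| ^ R) + ENNReal.ofReal (|w j x| ^ R)) := by
        intro x
        rw [← ENNReal.ofReal_add (by positivity) (by positivity),
          ← ENNReal.ofReal_mul (by positivity)]
        apply ENNReal.ofReal_le_ofReal
        have h1 := rpow_abs_le_two_rpow (x := w i x - w j x) (y := -w j x) hR0.le
        rwa [sub_neg_eq_add, sub_add_cancel, abs_neg] at h1
      refine (lintegral_mono hpt).trans ?_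
      have := (hw i).restrict (s := Metric.ball x₀ δ)
      rw [lintegral_const_mul' _ _ ENNReal.ofReal_ne_top, lintegral_add_left' (by fun_prop), hC',
        ENNReal.ofReal_mul (by positivity), ENNReal.ofReal_add (by linarith) (by linarith)]
      gcongr
      · exact h _ (hw i) (hwm i) (hwg i)
      · exact h _ (hw j) (hwm j) (hwg j)
    have hmain : ∀ M : ℝ, 1 ≤ M → ∀ i j, modular (volume.restrict (Metric.ball x₀ δ)) r (w i - w j)
        ≤ ENNReal.ofReal (M ^ R) * (∫⁻ x in Metric.ball 0 J, ‖w i x - w j x‖ₑ) +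
          ENNReal.ofReal (M ^ (-ε) * C') := by
      intro M hM i j
      have hM0 : 0 < M := by linarith
      have hpt : ∀ x ∈ Metric.ball x₀ δ, ENNReal.ofReal (|(w i - w j) x| ^ r x) ≤
          ENNReal.ofReal (M ^ R) * ‖w i x - w j x‖ₑ +
            ENNReal.ofReal (M ^ (-ε)) * ENNReal.ofReal (|(w i - w j) x| ^ R) := by
        intro x hx
        rw [Real.enorm_eq_ofReal_abs, ← ENNReal.ofReal_mul (by positivity),
          ← ENNReal.ofReal_mul (by positivity), ← ENNReal.ofReal_add (by positivity) (by positivity)]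
        exact ENNReal.ofReal_le_ofReal (rpow_le_mul_add_mul_rpow (abs_nonneg _) hM
          (hr.one_lt x).le hε (hrR x hx))
      refine (setLIntegral_mono' measurableSet_ball hpt).trans ?_
      have h1 := (hw i).restrict (s := Metric.ball x₀ δ)
      have h2 := (hw j).restrict (s := Metric.ball x₀ δ)
      rw [lintegral_add_left' (by fun_prop), lintegral_const_mul' _ _ ENNReal.ofReal_ne_top,
        lintegral_const_mul' _ _ ENNReal.ofReal_ne_top, ENNReal.ofReal_mul (by positivity)]
      gcongr
      exact hdiff i j
    rw [ENNReal.tendsto_nhds_zero]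
    intro e he
    have he2 : 0 < e / 2 := ENNReal.half_pos he.ne'
    have hM : Tendsto (fun M : ℝ => ENNReal.ofReal (M ^ (-ε) * C')) atTop (𝓝 0) := by
      have h1 := ENNReal.tendsto_ofReal ((tendsto_rpow_neg_atTop hε).mul_const C')
      simpa using h1
    obtain ⟨M, hMe, hM1⟩ :=
      ((ENNReal.tendsto_nhds_zero.1 hM (e / 2) he2).and (eventually_ge_atTop 1)).exists
    have hLJ := ENNReal.Tendsto.const_mul (a := ENNReal.ofReal (M ^ R)) (hL J)
      (Or.inr ENNReal.ofReal_ne_top)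
    rw [mul_zero] at hLJ
    filter_upwards [ENNReal.tendsto_nhds_zero.1 hLJ (e / 2) he2] with ij hij
    exact (hmain M hM1 _ _).trans ((add_le_add hij hMe).trans (ENNReal.add_halves e).le)

end LocalBounds

/-! ### Compactness in `L¹_loc` -/

section Compactness

variable {N : ℕ} {s : ℝ} {p : EuclideanSpace ℝ (Fin N) × EuclideanSpace ℝ (Fin N) → ℝ}
  {u : EuclideanSpace ℝ (Fin N) → ℝ}

lemma setLIntegral_enorm_le (hp : ∀ z, 1 ≤ p z)
    (hum : modular volume (fun x => p (x, x)) u ≤ 1) (S : Set (EuclideanSpace ℝ (Fin N))) :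
    ∫⁻ x in S, ‖u x‖ₑ ≤ volume S + 1 := by
  have hpt : ∀ x, ‖u x‖ₑ ≤ 1 + ENNReal.ofReal (|u x| ^ p (x, x)) := fun x => by
    rw [Real.enorm_eq_ofReal_abs, ← ENNReal.ofReal_one,
      ← ENNReal.ofReal_add (by positivity) (by positivity)]
    apply ENNReal.ofReal_le_ofReal
    simpa using rpow_le_one_add_rpow (abs_nonneg (u x)) zero_le_one (hp (x, x))
  refine (lintegral_mono hpt).trans ?_
  rw [lintegral_add_left measurable_const, setLIntegral_const, one_mul]
  gcongr
  exact (setLIntegral_le_lintegral _ _).trans hum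

lemma integrableOn_of_modular_le (hp : ∀ z, 1 ≤ p z) (hu : AEMeasurable u volume)
    (hum : modular volume (fun x => p (x, x)) u ≤ 1) {S : Set (EuclideanSpace ℝ (Fin N))}
    (hS : volume S < ∞) : IntegrableOn u S volume :=
  ⟨hu.aestronglyMeasurable.restrict, (setLIntegral_enorm_le hp hum S).trans_lt
    (ENNReal.add_lt_top.2 ⟨hS, ENNReal.one_lt_top⟩)⟩

lemma mul_lintegral_enorm_sub_mean_le {Q : Set (EuclideanSpace ℝ (Fin N))} {V : ℝ} (hV : 0 < V)
    (hvol : volume Q = ENNReal.ofReal V) (hu : IntegrableOn u Q volume) :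
    ENNReal.ofReal V * ∫⁻ y in Q, ‖u y - V⁻¹ * ∫ x in Q, u x‖ₑ ≤
      ∫⁻ y in Q, ∫⁻ x in Q, ‖u x - u y‖ₑ := by
  rw [← lintegral_const_mul' _ _ ENNReal.ofReal_ne_top]
  refine lintegral_mono fun y => ?_
  have hreal : volume.real Q = V := by
    rw [Measure.real, hvol, ENNReal.toReal_ofReal hV.le]
  have h1 : ∫ x in Q, (u x - u y) = -(V * (u y - V⁻¹ * ∫ x in Q, u x)) := by
    rw [integral_sub hu (integrableOn_const (by rw [hvol]; exact ENNReal.ofReal_ne_top)),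
      setIntegral_const, hreal, smul_eq_mul, mul_sub, ← mul_assoc, mul_inv_cancel₀ hV.ne']
    ring
  calc ENNReal.ofReal V * ‖u y - V⁻¹ * ∫ x in Q, u x‖ₑ
      = ‖∫ x in Q, (u x - u y)‖ₑ := by
        rw [h1, enorm_neg, enorm_mul, Real.enorm_eq_ofReal hV.le]
    _ ≤ _ := enorm_integral_le_lintegral_enorm _

/-- On a cube of side length `h` a function differs in `L¹` from its mean by `O(h^s)` times its
Gagliardo modular, up to an additive term of the same order. -/
lemma lintegral_enorm_sub_mean_le (hs : 0 < s) (hp : ∀ z, 1 ≤ p z) {h : ℝ} (hh : 0 < h)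
    {k : Fin N → ℤ} (hu : IntegrableOn u (gridCube h k) volume) :
    ∫⁻ y in gridCube h k, ‖u y - (h ^ N)⁻¹ * ∫ x in gridCube h k, u x‖ₑ ≤
      ENNReal.ofReal ((N * h) ^ s) * (volume (gridCube h k) + ENNReal.ofReal ((N : ℝ) ^ N) *
        ∫⁻ y in gridCube h k, ∫⁻ x in gridCube h k, gagliardoKernel s p u x y) := by
  have hV : 0 < h ^ N := by positivity
  have hvol : volume (gridCube h k) = ENNReal.ofReal (h ^ N) := volume_gridCube hh
  have hpt : ∀ y ∈ gridCube h k, ∀ x ∈ gridCube h k, ‖u x - u y‖ₑ ≤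
      ENNReal.ofReal ((N * h) ^ s) *
        (1 + ENNReal.ofReal ((N * h) ^ N) * gagliardoKernel s p u x y) := by
    intro y hy x hx
    have h1 := rpow_abs_sub_le_gagliardoKernel (s := s) (u := u) one_pos (hp (x, y))
    rw [Real.rpow_one, mul_one, ← Real.enorm_eq_ofReal_abs, Real.rpow_natCast] at h1
    have := norm_sub_le_of_mem_gridCube hh hx hy
    exact h1.trans (by gcongr)
  rw [← ENNReal.mul_le_mul_iff_right (a := ENNReal.ofReal (h ^ N))
    (ENNReal.ofReal_pos.2 hV).ne' ENNReal.ofReal_ne_top]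
  refine (mul_lintegral_enorm_sub_mean_le hV hvol hu).trans ?_
  calc ∫⁻ y in gridCube h k, ∫⁻ x in gridCube h k, ‖u x - u y‖ₑ
      ≤ ∫⁻ y in gridCube h k, ∫⁻ x in gridCube h k, ENNReal.ofReal ((N * h) ^ s) *
        (1 + ENNReal.ofReal ((N * h) ^ N) * gagliardoKernel s p u x y) :=
        setLIntegral_mono' measurableSet_gridCube fun y hy =>
          setLIntegral_mono' measurableSet_gridCube fun x hx => hpt y hy x hx
    _ = ENNReal.ofReal ((N * h) ^ s) * (ENNReal.ofReal (h ^ N) * ENNReal.ofReal (h ^ N) +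
          ENNReal.ofReal ((N * h) ^ N) *
            ∫⁻ y in gridCube h k, ∫⁻ x in gridCube h k, gagliardoKernel s p u x y) := by
        simp_rw [lintegral_const_mul' _ _ ENNReal.ofReal_ne_top,
          lintegral_add_left measurable_const, lintegral_const_mul' _ _ ENNReal.ofReal_ne_top,
          setLIntegral_const, hvol, one_mul]
    _ = _ := by
        rw [hvol, mul_pow, ENNReal.ofReal_mul (by positivity)]
        ring

lemma exists_finset_ball_subset {h : ℝ} (hh : 0 < h) (hh1 : h ≤ 1) (J : ℝ) :
    ∃ S : Finset (Fin N → ℤ), Metric.ball 0 J ⊆ ⋃ k ∈ S, gridCube h k ∧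
      ∀ k ∈ S, gridCube h k ⊆ Metric.ball (0 : EuclideanSpace ℝ (Fin N)) (J + N) := by
  have hfin : {k : Fin N → ℤ | (gridCube h k ∩ Metric.ball 0 J).Nonempty}.Finite := by
    refine (Set.finite_Icc (fun _ : Fin N => ⌊-J / h⌋) (fun _ => ⌊J / h⌋)).subset ?_
    rintro k ⟨x, hx, hxJ⟩
    rw [mem_ball_zero_iff] at hxJ
    have hxi : ∀ i, |x i| ≤ J := fun i => by
      have := PiLp.norm_apply_le x i
      rw [Real.norm_eq_abs] at this
      linarith
    refine ⟨fun i => ?_, fun i => ?_⟩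
    · rw [← hx i]
      have := (abs_le.1 (hxi i)).1
      exact Int.floor_le_floor (by gcongr)
    · rw [← hx i]
      have := (abs_le.1 (hxi i)).2
      exact Int.floor_le_floor (by gcongr)
  refine ⟨hfin.toFinset, fun x hx => ?_, fun k hk y hy => ?_⟩
  · have hx' : x ∈ gridCube h fun i => ⌊x i / h⌋ := fun i => rfl
    simp only [Set.mem_iUnion]
    exact ⟨_, hfin.mem_toFinset.2 ⟨x, hx', hx⟩, hx'⟩
  · obtain ⟨x, hx, hxJ⟩ := hfin.mem_toFinset.1 hk
    rw [mem_ball_zero_iff] at hxJ ⊢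
    have h1 := norm_sub_le_of_mem_gridCube hh hy hx
    have h2 := norm_le_norm_sub_add y x
    have h3 : N * h ≤ N * 1 := by gcongr
    linarith

/-- The `L¹` distance on a ball of two functions in the unit ball of the Sobolev space is small
once finitely many of their cube integrals are close. -/
lemma exists_finset_lintegral_enorm_sub_le (hs : 0 < s) (hp : ∀ z, 1 ≤ p z) {h : ℝ} (hh : 0 < h)
    (hh1 : h ≤ 1) (J : ℝ) :
    ∃ S : Finset (Fin N → ℤ), ∀ u w : EuclideanSpace ℝ (Fin N) → ℝ,
      AEMeasurable u volume → AEMeasurable w volume →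
      modular volume (fun x => p (x, x)) u ≤ 1 → modular volume (fun x => p (x, x)) w ≤ 1 →
      gagliardoModular s p u 1 ≤ 1 → gagliardoModular s p w 1 ≤ 1 →
      ∫⁻ x in Metric.ball 0 J, ‖u x - w x‖ₑ ≤
        ENNReal.ofReal ((N * h) ^ s) *
          (2 * (volume (Metric.ball (0 : EuclideanSpace ℝ (Fin N)) (J + N)) +
            ENNReal.ofReal ((N : ℝ) ^ N))) +
        ∑ k ∈ S, ‖(∫ x in gridCube h k, u x) - ∫ x in gridCube h k, w x‖ₑ := by
  obtain ⟨S, hS, hSb⟩ := exists_finset_ball_subset (N := N) hh hh1 J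
  refine ⟨S, fun u w hu hw hum hwm hug hwg => ?_⟩
  have hvol : ∀ k, volume (gridCube (N := N) h k) = ENNReal.ofReal (h ^ N) :=
    fun k => volume_gridCube hh
  have hvol' : ∀ k, volume (gridCube (N := N) h k) < ∞ := fun k => by
    rw [hvol]; exact ENNReal.ofReal_lt_top
  have hosc : ∀ v : EuclideanSpace ℝ (Fin N) → ℝ, AEMeasurable v volume →
      modular volume (fun x => p (x, x)) v ≤ 1 → gagliardoModular s p v 1 ≤ 1 →
      ∑ k ∈ S, ∫⁻ y in gridCube h k, ‖v y - (h ^ N)⁻¹ * ∫ x in gridCube h k, v x‖ₑ ≤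
        ENNReal.ofReal ((N * h) ^ s) *
          (volume (Metric.ball (0 : EuclideanSpace ℝ (Fin N)) (J + N)) +
            ENNReal.ofReal ((N : ℝ) ^ N)) := by
    intro v hv hvm hvg
    refine (Finset.sum_le_sum fun k _ => lintegral_enorm_sub_mean_le hs hp hh
      (integrableOn_of_modular_le hp hv hvm (hvol' k))).trans ?_
    rw [← Finset.mul_sum, Finset.sum_add_distrib, ← Finset.mul_sum]
    gcongr
    · calc ∑ k ∈ S, volume (gridCube h k)
          = volume (⋃ k ∈ S, gridCube (N := N) h k) :=
            (measure_biUnion_finset (fun _ _ _ _ hkl => pairwise_disjoint_gridCube hkl)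
              fun _ _ => measurableSet_gridCube).symm
        _ ≤ _ := measure_mono (Set.iUnion₂_subset hSb)
    · refine mul_le_of_le_one_right' ?_
      refine le_trans (Finset.sum_le_sum fun k _ => ?_) ((sum_lintegral_gridCube_le (h := h) S
        fun y => ∫⁻ x, gagliardoKernel s p v x y).trans (gagliardoModular_one.ge.trans hvg))
      exact lintegral_mono fun y => setLIntegral_le_lintegral _ _
  have hcube : ∀ k ∈ S, ∫⁻ y in gridCube h k, ‖u y - w y‖ₑ ≤
      ((∫⁻ y in gridCube h k, ‖u y - (h ^ N)⁻¹ * ∫ x in gridCube h k, u x‖ₑ) +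
        ∫⁻ y in gridCube h k, ‖w y - (h ^ N)⁻¹ * ∫ x in gridCube h k, w x‖ₑ) +
      ‖(∫ x in gridCube h k, u x) - ∫ x in gridCube h k, w x‖ₑ := by
    intro k _
    set a := ∫ x in gridCube h k, u x
    set b := ∫ x in gridCube h k, w x
    have hpt : ∀ y, ‖u y - w y‖ₑ ≤ (‖u y - (h ^ N)⁻¹ * a‖ₑ + ‖w y - (h ^ N)⁻¹ * b‖ₑ) +
        ‖(h ^ N)⁻¹ * (a - b)‖ₑ := by
      intro y
      have e : u y - w y = (u y - (h ^ N)⁻¹ * a) + (-(w y - (h ^ N)⁻¹ * b)) +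
        (h ^ N)⁻¹ * (a - b) := by ring
      rw [e]
      refine (enorm_add_le _ _).trans ?_
      gcongr
      refine (enorm_add_le _ _).trans ?_
      rw [enorm_neg]
    refine (lintegral_mono hpt).trans ?_
    have hu' := hu.restrict (s := gridCube h k)
    rw [lintegral_add_right' _ (by fun_prop), lintegral_add_left' (by fun_prop),
      setLIntegral_const, hvol, enorm_mul, Real.enorm_eq_ofReal (by positivity),
      mul_right_comm, ← ENNReal.ofReal_mul (by positivity), inv_mul_cancel₀ (by positivity),
      ENNReal.ofReal_one, one_mul]
  calc ∫⁻ x in Metric.ball 0 J, ‖u x - w x‖ₑ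
      ≤ ∫⁻ x in ⋃ k ∈ S, gridCube h k, ‖u x - w x‖ₑ := lintegral_mono_set hS
    _ = ∑ k ∈ S, ∫⁻ x in gridCube h k, ‖u x - w x‖ₑ :=
        lintegral_biUnion_finset (fun _ _ _ _ hkl => pairwise_disjoint_gridCube hkl)
          (fun _ _ => measurableSet_gridCube) _
    _ ≤ _ := Finset.sum_le_sum hcube
    _ ≤ _ := by
        rw [Finset.sum_add_distrib, Finset.sum_add_distrib, two_mul, mul_add]
        gcongr
        · exact hosc u hu hum hug
        · exact hosc w hw hwm hwg

/-- Compactness in `L¹_loc`: along a subsequence all integrals over the cubes of the grids of side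
length `1 / (j + 1)` converge, which makes the subsequence Cauchy on every ball. -/
lemma exists_subseq_cauchy (hs : 0 < s) (hp : ∀ z, 1 ≤ p z)
    {u : ℕ → EuclideanSpace ℝ (Fin N) → ℝ} (hu : ∀ n, AEMeasurable (u n) volume)
    (hum : ∀ n, modular volume (fun x => p (x, x)) (u n) ≤ 1)
    (hug : ∀ n, gagliardoModular s p (u n) 1 ≤ 1) :
    ∃ φ : ℕ → ℕ, StrictMono φ ∧ ∀ J : ℕ, Tendsto (fun ij : ℕ × ℕ =>
      ∫⁻ x in Metric.ball 0 J, ‖u (φ ij.1) x - u (φ ij.2) x‖ₑ) atTop (𝓝 0) := by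
  set h : ℕ → ℝ := fun j => 1 / ((j : ℝ) + 1) with hh
  have hh0 : ∀ j, 0 < h j := fun j => by positivity
  have hh1 : ∀ j, h j ≤ 1 := fun j => by
    rw [hh]; simp only
    rw [div_le_one (by positivity)]
    linarith [(Nat.cast_nonneg j : (0 : ℝ) ≤ j)]
  set I : ℕ → (ℕ × (Fin N → ℤ)) → ℝ := fun n jk => ∫ x in gridCube (h jk.1) jk.2, u n x with hI
  have hbox : IsCompact (Set.pi Set.univ fun jk : ℕ × (Fin N → ℤ) =>
      Set.Icc (-(h jk.1 ^ N + 1)) (h jk.1 ^ N + 1)) := isCompact_univ_pi fun _ => isCompact_Icc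
  obtain ⟨a, -, φ, hφ, hlim⟩ := hbox.tendsto_subseq (x := I) (fun n jk _ => by
    have h0 := hh0 jk.1
    rw [Set.mem_Icc, ← abs_le, ← ENNReal.ofReal_le_ofReal_iff (by positivity),
      ← Real.enorm_eq_ofReal_abs]
    refine (enorm_integral_le_lintegral_enorm _).trans
      ((setLIntegral_enorm_le hp (hum n) _).trans (le_of_eq ?_))
    rw [volume_gridCube h0, ENNReal.ofReal_add (by positivity) one_pos.le, ENNReal.ofReal_one])
  rw [tendsto_pi_nhds] at hlim
  refine ⟨φ, hφ, fun J => ENNReal.tendsto_nhds_zero.2 fun e he => ?_⟩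
  have he2 : 0 < e / 2 := ENNReal.half_pos he.ne'
  have hsmall : Tendsto (fun j => ENNReal.ofReal ((N * h j) ^ s) *
      (2 * (volume (Metric.ball (0 : EuclideanSpace ℝ (Fin N)) (J + N)) +
        ENNReal.ofReal ((N : ℝ) ^ N)))) atTop (𝓝 0) := by
    have h1 : Tendsto (fun j => (N * h j) ^ s) atTop (𝓝 0) := by
      have h2 : Tendsto (fun j => N * h j) atTop (𝓝 0) := by
        simpa [hh] using tendsto_one_div_add_atTop_nhds_zero_nat.const_mul (N : ℝ)
      have h3 := h2.rpow_const (p := s) (Or.inr hs.le)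
      rwa [Real.zero_rpow hs.ne'] at h3
    have h4 := ENNReal.Tendsto.mul_const (ENNReal.tendsto_ofReal h1) (b :=
      (2 * (volume (Metric.ball (0 : EuclideanSpace ℝ (Fin N)) (J + N)) +
        ENNReal.ofReal ((N : ℝ) ^ N)))) (Or.inr (ENNReal.mul_ne_top (by simp)
          (ENNReal.add_ne_top.2 ⟨measure_ball_lt_top.ne, ENNReal.ofReal_ne_top⟩)))
    simpa using h4
  obtain ⟨j, hj⟩ := (ENNReal.tendsto_nhds_zero.1 hsmall (e / 2) he2).exists
  obtain ⟨S, hS⟩ := exists_finset_lintegral_enorm_sub_le (p := p) hs hp (hh0 j) (hh1 j) J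
  have hsum : Tendsto (fun ij : ℕ × ℕ => ∑ k ∈ S, ‖I (φ ij.1) (j, k) - I (φ ij.2) (j, k)‖ₑ)
      atTop (𝓝 0) := by
    rw [← prod_atTop_atTop_eq]
    have : Tendsto (fun ij : ℕ × ℕ => ∑ k ∈ S, ‖I (φ ij.1) (j, k) - I (φ ij.2) (j, k)‖ₑ)
        (atTop ×ˢ atTop) (𝓝 (∑ k ∈ S, ‖a (j, k) - a (j, k)‖ₑ)) :=
      tendsto_finsetSum _ fun k _ =>
        (((hlim (j, k)).comp tendsto_fst).sub ((hlim (j, k)).comp tendsto_snd)).enorm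
    simpa using this
  filter_upwards [ENNReal.tendsto_nhds_zero.1 hsum (e / 2) he2] with ij hij
  exact (hS _ _ (hu _) (hu _) (hum _) (hum _) (hug _) (hug _)).trans
    ((add_le_add hj hij).trans (ENNReal.add_halves e).le)

/-- A sequence that is Cauchy in `L¹_loc` has a subsequence converging almost everywhere. -/
lemma exists_subseq_ae_tendsto {w : ℕ → EuclideanSpace ℝ (Fin N) → ℝ}
    (hw : ∀ n, AEMeasurable (w n) volume)
    (hL : ∀ J : ℕ, Tendsto (fun ij : ℕ × ℕ => ∫⁻ x in Metric.ball 0 J, ‖w ij.1 x - w ij.2 x‖ₑ)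
      atTop (𝓝 0)) :
    ∃ ψ : ℕ → ℕ, StrictMono ψ ∧ ∃ v : EuclideanSpace ℝ (Fin N) → ℝ, Measurable v ∧
      ∀ᵐ x, Tendsto (fun n => w (ψ n) x) atTop (𝓝 (v x)) := by
  have hpow : ∀ J : ℕ, (0 : ℝ≥0∞) < (1 / 2) ^ J := fun J =>
    ENNReal.pow_pos (ENNReal.div_pos one_ne_zero (by simp)) J
  obtain ⟨ψ, hψ, hψL⟩ := extraction_forall_of_eventually (P := fun J n => ∀ i ≥ n, ∀ j ≥ n,
      ∫⁻ x in Metric.ball 0 J, ‖w i x - w j x‖ₑ < (1 / 2) ^ J) (fun J => by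
    obtain ⟨⟨a, b⟩, hab⟩ := eventually_atTop.1 ((hL J).eventually_lt_const (hpow J))
    filter_upwards [eventually_ge_atTop (max a b)] with n hn i hi j hj
    exact hab (i, j) ⟨(le_max_left _ _).trans (hn.trans hi), (le_max_right _ _).trans (hn.trans hj)⟩)
  refine ⟨ψ, hψ, measurable_limit_of_tendsto_metrizable_ae (fun n => hw (ψ n)) ?_⟩
  have hball : ∀ J : ℕ, ∀ᵐ x ∂(volume.restrict (Metric.ball (0 : EuclideanSpace ℝ (Fin N)) J)),
      ∃ l : ℝ, Tendsto (fun n => w (ψ n) x) atTop (𝓝 l) := by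
    intro J
    have h1 := Lp.ae_tendsto_of_cauchy_eLpNorm
      (μ := volume.restrict (Metric.ball (0 : EuclideanSpace ℝ (Fin N)) J))
      (f := fun n => w (ψ (n + J))) (B := fun n => (1 / 2) ^ n)
      (fun n => (hw _).aestronglyMeasurable.restrict) le_rfl (by
        rw [ENNReal.tsum_geometric]; simp) (fun M n m hn hm => by
        rw [eLpNorm_one_eq_lintegral_enorm]
        have h2 : Metric.ball (0 : EuclideanSpace ℝ (Fin N)) (J : ℝ) ⊆
            Metric.ball 0 ((M + J : ℕ) : ℝ) := Metric.ball_subset_ball (by push_cast; simp)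
        refine ((lintegral_mono_set h2).trans_lt (hψL (M + J) _
          (hψ.monotone (by omega : M + J ≤ n + J)) _
          (hψ.monotone (by omega : M + J ≤ m + J)))).trans_le ?_
        exact pow_le_pow_of_le_one zero_le (by simp) (by omega))
    filter_upwards [h1] with x ⟨l, hl⟩
    exact ⟨l, (tendsto_add_atTop_iff_nat J).1 hl⟩
  have hU : (⋃ J : ℕ, Metric.ball (0 : EuclideanSpace ℝ (Fin N)) (J : ℝ)) = Set.univ := by
    ext x
    simp
  rw [← Measure.restrict_univ (μ := volume), ← hU, ae_restrict_iUnion_iff]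
  exact hball

end Compactness

/-! ### The compact local embedding -/

section CompactEmbedding

variable {N : ℕ} {s : ℝ} {p : EuclideanSpace ℝ (Fin N) × EuclideanSpace ℝ (Fin N) → ℝ}
  {r : EuclideanSpace ℝ (Fin N) → ℝ}

lemma CPlus.pos {X : Type*} [TopologicalSpace X] {h : X → ℝ} (hh : CPlus h) (x : X) :
    0 < h x := zero_lt_one.trans (hh.one_lt x)

/-- Fatou's lemma for modulars. -/
lemma modular_le_liminf {μ : Measure (EuclideanSpace ℝ (Fin N))} (hr : CPlus r)
    {f : ℕ → EuclideanSpace ℝ (Fin N) → ℝ} {g : EuclideanSpace ℝ (Fin N) → ℝ}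
    (hf : ∀ n, AEMeasurable (f n) μ) (h : ∀ᵐ x ∂μ, Tendsto (fun n => f n x) atTop (𝓝 (g x))) :
    modular μ r g ≤ liminf (fun n => modular μ r (f n)) atTop := by
  have hrm : Measurable r := hr.1.measurable
  have h1 : modular μ r g =
      ∫⁻ x, liminf (fun n => ENNReal.ofReal (|f n x| ^ r x)) atTop ∂μ := by
    refine lintegral_congr_ae ?_
    filter_upwards [h] with x hx
    exact (ENNReal.tendsto_ofReal (hx.abs.rpow_const (Or.inr (hr.pos x).le))).liminf_eq.symm
  rw [h1]
  exact lintegral_liminf_le' fun n => by have := hf n; fun_prop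

/-- Every sequence in the unit ball of the Sobolev space has a subsequence that converges for the
modular of every compact set. -/
lemma exists_subseq_tendsto_modular (hs0 : 0 < s) (hp : CPlus p)
    (hsp : s * (⨆ z, p z) < N) (hr : CPlus r) (hrc : ∀ x, r x < criticalExponent s p x)
    {u : ℕ → EuclideanSpace ℝ (Fin N) → ℝ} (hu : ∀ n, AEMeasurable (u n) volume)
    (hum : ∀ n, modular volume (fun x => p (x, x)) (u n) ≤ 1)
    (hug : ∀ n, gagliardoModular s p (u n) 1 ≤ 1) :
    ∃ φ : ℕ → ℕ, StrictMono φ ∧ ∃ v ∈ lebesgueLocSpace r,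
      ∀ K : Set (EuclideanSpace ℝ (Fin N)), IsCompact K →
        Tendsto (fun n => modular (volume.restrict K) r (u (φ n) - v)) atTop (𝓝 0) := by
  obtain ⟨φ, hφ, hL⟩ := exists_subseq_cauchy hs0 (fun z => (hp.one_lt z).le) hu hum hug
  obtain ⟨ψ, hψ, v, hv, hlim⟩ := exists_subseq_ae_tendsto (fun n => hu (φ n)) hL
  refine ⟨φ ∘ ψ, hφ.comp hψ, v, fun K hK => ⟨hv.aemeasurable, ?_⟩, fun K hK => ?_⟩
  · obtain ⟨C, -, hC⟩ := exists_modular_restrict_le hs0 hp hsp hr hrc hK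
    refine lt_of_le_of_lt (modular_le_liminf hr (fun n => (hu (φ (ψ n))).restrict)
      (ae_restrict_of_ae hlim)) (lt_of_le_of_lt ?_ (ENNReal.ofReal_lt_top (r := C)))
    exact (liminf_le_liminf (Eventually.of_forall fun n => hC _ (hu _) (hum _) (hug _))).trans
      (by simp)
  · have hψ2 : Tendsto (fun ij : ℕ × ℕ => (ψ ij.1, ψ ij.2)) atTop atTop := by
      rw [← prod_atTop_atTop_eq]
      exact hψ.tendsto_atTop.prodMap hψ.tendsto_atTop
    have hcau := tendsto_modular_sub hs0 hp hsp hr hrc (w := fun n => u (φ (ψ n)))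
      (fun n => hu _) (fun n => hum _) (fun n => hug _) (fun J => (hL J).comp hψ2) hK
    rw [ENNReal.tendsto_nhds_zero] at hcau ⊢
    intro e he
    obtain ⟨⟨a, b⟩, hab⟩ := eventually_atTop.1 (hcau e he)
    filter_upwards [eventually_ge_atTop a] with i hi
    have hfatou : modular (volume.restrict K) r (u (φ (ψ i)) - v) ≤
        liminf (fun j => modular (volume.restrict K) r (u (φ (ψ i)) - u (φ (ψ j)))) atTop := by
      refine modular_le_liminf hr (fun j => ((hu _).sub (hu _)).restrict) (ae_restrict_of_ae ?_)
      filter_upwards [hlim] with x hx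
      exact tendsto_const_nhds.sub hx
    refine hfatou.trans ((liminf_le_liminf (v := fun _ => e) ?_).trans (by simp))
    filter_upwards [eventually_ge_atTop b] with j hj
    exact hab (i, j) ⟨hi, hj⟩

lemma tendsto_luxemburgNorm_of_modular {X : Type*} [TopologicalSpace X] [MeasurableSpace X]
    {μ : Measure X} {q : X → ℝ} (hq : CPlus q) {f : ℕ → X → ℝ}
    (h : Tendsto (fun n => modular μ q (f n)) atTop (𝓝 0)) {t : ℝ} (ht : 1 ≤ t) :
    Tendsto (fun n => luxemburgNorm μ q (fun x => t * f n x)) atTop (𝓝 0) := by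
  rw [ENNReal.tendsto_nhds_zero]
  intro e he
  obtain ⟨τ, hτ0, hτe⟩ := ENNReal.lt_iff_exists_nnreal_btwn.1 he
  have hτ : 0 < (τ : ℝ) := by exact_mod_cast hτ0
  set c := max 1 (t / τ) with hc
  have h1 := ENNReal.Tendsto.const_mul (a := ENNReal.ofReal (c ^ (⨆ x, q x))) h
    (Or.inr ENNReal.ofReal_ne_top)
  rw [mul_zero] at h1
  filter_upwards [ENNReal.tendsto_nhds_zero.1 h1 1 one_pos] with n hn
  have h2 : modular μ q (fun x => t * f n x / τ) ≤ 1 := by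
    refine le_trans ?_ ((modular_mul_le (le_max_left 1 (t / τ)) hq.le_iSup).trans hn)
    refine modular_mono (fun x => (hq.pos x).le) fun x => ?_
    rw [mul_div_right_comm, abs_mul, abs_mul]
    gcongr
    exact le_max_right _ _
  calc luxemburgNorm μ q (fun x => t * f n x) ≤ ENNReal.ofReal τ := iInf₂_le _ ⟨hτ, h2⟩
    _ ≤ e := by rw [ENNReal.ofReal_coe_nnreal]; exact hτe.le

lemma compactlyEmbedsLoc_sobolevSpace (hs0 : 0 < s) (hp : CPlus p)
    (hsp : s * (⨆ z, p z) < N) (hr : CPlus r) (hrc : ∀ x, r x < criticalExponent s p x) :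
    CompactlyEmbedsLoc (sobolevSpace s p) (sobolevNorm s p) r := by
  have hbound : ∀ K : Set (EuclideanSpace ℝ (Fin N)), IsCompact K → ∃ C : ℝ≥0,
      ∀ u ∈ sobolevSpace s p, u ∈ lebesgueSpace (volume.restrict K) r ∧
        luxemburgNorm (volume.restrict K) r u ≤ C * sobolevNorm s p u := by
    intro K hK
    obtain ⟨C, hC, h⟩ := exists_modular_restrict_le hs0 hp hsp hr hrc hK
    exact ⟨C.toNNReal, fun u hu => luxemburgNorm_le_mul_sobolevNorm hp
      Measure.restrict_le_self.absolutelyContinuous hr hC h hu⟩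
  refine ⟨fun u hu K hK => ?_, fun K hK => ?_, ?_⟩
  · obtain ⟨C, h⟩ := hbound K hK
    exact (h u hu).1
  · obtain ⟨C, h⟩ := hbound K hK
    exact ⟨C, fun u hu => (h u hu).2⟩
  rintro u hu ⟨M, hM⟩
  set t : ℝ := M + 1 with ht
  have ht1 : 1 ≤ t := by rw [ht]; linarith [M.coe_nonneg]
  have ht0 : 0 < t := by positivity
  have hlt : ∀ n, sobolevNorm s p (u n) < ENNReal.ofReal t := fun n => by
    refine (hM n).trans_lt ?_
    rw [← ENNReal.ofReal_coe_nnreal]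
    exact (ENNReal.ofReal_lt_ofReal_iff ht0).2 (by rw [ht]; linarith)
  have hunit := fun n => modular_div_le_one_of_sobolevNorm_lt (fun z => (hp.pos z).le) ht0 (hlt n)
  obtain ⟨φ, hφ, v, hv, hconv⟩ := exists_subseq_tendsto_modular hs0 hp hsp hr hrc
    (u := fun n x => u n x / t) (fun n => (hu n).1.1.div_const t)
    (fun n => (hunit n).1) (fun n => (hunit n).2)
  refine ⟨φ, hφ, fun x => t * v x, fun K hK => ⟨(hv K hK).1.const_mul t, ?_⟩, fun K hK => ?_⟩
  · exact (modular_mul_le ht1 hr.le_iSup).trans_lt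
      (ENNReal.mul_lt_top ENNReal.ofReal_lt_top (hv K hK).2)
  · refine (tendsto_luxemburgNorm_of_modular hr (hconv K hK) ht1).congr fun n => ?_
    congr 1
    funext x
    simp only [Pi.sub_apply]
    field_simp

end CompactEmbedding

end VarSobolev

theorem theorem3p5 (N : ℕ) (s : ℝ) (hs0 : 0 < s) (hs1 : s < 1)
    (p : EuclideanSpace ℝ (Fin N) × EuclideanSpace ℝ (Fin N) → ℝ)
    (hp : VarSobolev.CPlus p) (hpu : UniformContinuous p)
    (hsymm : ∀ x y, p (x, y) = p (y, x))
    (hsp : s * (⨆ z, p z) < N) :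
    (∀ r : EuclideanSpace ℝ (Fin N) → ℝ, VarSobolev.CPlus r → UniformContinuous r →
      (∀ x, p (x, x) ≤ r x) →
      0 < ⨅ x, (VarSobolev.criticalExponent s p x - r x) →
      VarSobolev.ContinuouslyEmbeds
        (VarSobolev.sobolevSpace s p) (VarSobolev.sobolevNorm s p)
        (VarSobolev.lebesgueSpace volume r) (VarSobolev.luxemburgNorm volume r)) ∧
    (∀ r : EuclideanSpace ℝ (Fin N) → ℝ, VarSobolev.CPlus r →
      (∀ x, r x < VarSobolev.criticalExponent s p x) →
      VarSobolev.CompactlyEmbedsLoc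
        (VarSobolev.sobolevSpace s p) (VarSobolev.sobolevNorm s p) r) := by
  refine ⟨fun r hr hru hpr hgap => ?_, fun r hr hrc =>
    VarSobolev.compactlyEmbedsLoc_sobolevSpace hs0 hp hsp hr hrc⟩
  obtain ⟨C, hC, h⟩ := VarSobolev.exists_modular_le hs0 hp hpu hsp hr hru hpr hgap
  have key := fun u hu => VarSobolev.luxemburgNorm_le_mul_sobolevNorm (u := u) hp
    Measure.AbsolutelyContinuous.rfl hr hC h hu
  exact ⟨fun u hu => (key u hu).1, C.toNNReal, fun u hu => (key u hu).2⟩
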